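/- Consider perfect matchings of $n$ labelled points on a circle (equivalently of $\{1,\dots,n\}$), each pair being drawn as a chord; two chords $\{a,c\}$ and $\{b,d\}$ cross if $a<b<c<d$. Labelling the points amounts to rooting the matching, that is, marking an arc between two consecutive points. A $k$-core matching is a perfect matching with exactly $k$ crossings in which every chord is involved in a crossing. The core of a perfect matching $M$ is the submatching formed by its chords involved in at least one crossing, with its points relabelled increasingly. For a $k$-core matching $K$, let $n_i(K)$ be the number of regions of $K$ (connected components of the complement of the chords in the disk) whose intersection with the circle consists of $i$ arcs; $K$ is called maximal if it maximizes the potential $\sum_{i>1}(2i-3)\,n_i(K)$ among all $k$-core matchings. Let $k\ge 1$. The number $M_k(2m)$ of perfect matchings with $k$ crossings on $2m$ points satisfies $$M_k(2m)=\frac{(2k-3)!!}{2^{k-1}\,k!\;\Gamma\big(k-\tfrac12\big)}\;m^{k-\frac32}\,4^m\,(1+o(1))\qquad(m\to\infty),$$ where $(2k-3)!!=(2k-3)(2k-5)\cdots 3\cdot 1$ and $(-1)!!=1$. Moreover, the dominant contribution comes from the maximal $k$-cores: the number of perfect matchings with $k$ crossings on $2m$ points whose core is a maximal $k$-core is $M_k(2m)\,(1+o(1))$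 as $m\to\infty$. There are exactly four (rooted) maximal $k$-core matchings if $k\ge 2$, and exactly one if $k=1$. -/

import Mathlib

/-- A (rooted) perfect matching of `n` points on a circle. The points are labelled
`0, 1, …, n - 1` counterclockwise, starting just after the root, and the matching is given by the
map that sends a point to the other endpoint of its chord, a fixed-point-free involution. -/
abbrev PerfectMatching (n : ℕ) : Type :=
  {f : Fin n → Fin n // ∀ v, f (f v) = v ∧ f v ≠ v}

namespace PerfectMatching

variable {n : ℕ}

/-- The crossings of `M`: two chords `{a, c}` and `{b, d}` cross when `a < b < c < d`, and this
crossing is recorded once, by its pair `(a, b)` of first endpoints. -/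
def crossings (M : PerfectMatching n) : Finset (Fin n × Fin n) :=
  {p : Fin n × Fin n | p.1 < p.2 ∧ p.2 < M.1 p.1 ∧ M.1 p.1 < M.1 p.2}

/-- The points whose chord is involved in at least one crossing. -/
def crossingVertices (M : PerfectMatching n) : Finset (Fin n) :=
  {v : Fin n | ∃ p ∈ M.crossings, v = p.1 ∨ v = M.1 p.1 ∨ v = p.2 ∨ v = M.1 p.2}

/-- `M` is a `k`-core matching: every chord is involved in a crossing, and there are exactly `k`
crossings. -/
def IsKCore (k : ℕ) (M : PerfectMatching n) : Prop :=
  (∀ v, v ∈ M.crossingVertices) ∧ M.crossings.card = k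

theorem partner_mem_crossingVertices (M : PerfectMatching n) {v : Fin n}
    (hv : v ∈ M.crossingVertices) : M.1 v ∈ M.crossingVertices := by
  simp only [crossingVertices, Finset.mem_filter, Finset.mem_univ, true_and] at hv ⊢
  obtain ⟨p, hp, h⟩ := hv
  refine ⟨p, hp, ?_⟩
  rcases h with rfl | rfl | rfl | rfl
  · exact Or.inr (Or.inl rfl)
  · exact Or.inl (M.2 _).1
  · exact Or.inr (Or.inr (Or.inr rfl))
  · exact Or.inr (Or.inr (Or.inl (M.2 _).1))

/-- The core of `M`: the submatching formed by the chords involved in at least one crossing, its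
points being relabelled increasingly (so that the root of `M` lies on the root arc of the core). -/
def core (M : PerfectMatching n) : PerfectMatching M.crossingVertices.card :=
  ⟨fun v =>
    (M.crossingVertices.orderIsoOfFin rfl).symm
      ⟨M.1 (M.crossingVertices.orderIsoOfFin rfl v),
        M.partner_mem_crossingVertices (M.crossingVertices.orderIsoOfFin rfl v).2⟩, by
    intro v
    constructor
    · rw [OrderIso.symm_apply_eq]
      apply Subtype.ext
      simp only [OrderIso.apply_symm_apply]
      exact (M.2 _).1
    · intro h
      have h' := congrArg (M.crossingVertices.orderIsoOfFin rfl) h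
      rw [OrderIso.apply_symm_apply] at h'
      exact (M.2 _).2 (congrArg Subtype.val h')⟩

/-- The points cut the circle into `n` arcs; arc `a` is the one that ends at point `a` in
counterclockwise direction, so arc `0` is the root arc. The chord `{v, w}` with `v < w` has the arcs
`a` with `v < a ≤ w` on one side and all others on the other side. The regions of `M` are the
connected components of the disk minus the (straight) chords, i.e. the sets of points lying on
prescribed sides of all chords; hence two arcs bound the same region iff no chord separates them. -/
def SameRegion (M : PerfectMatching n) (a b : Fin n) : Prop :=
  ∀ v, v < M.1 v → ((v < a ∧ a ≤ M.1 v) ↔ (v < b ∧ b ≤ M.1 v))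

instance (M : PerfectMatching n) (a b : Fin n) : Decidable (M.SameRegion a b) := by
  unfold SameRegion; infer_instance

/-- The regions of `M` with at least one boundary arc, each given as the set of its boundary
arcs. -/
def regions (M : PerfectMatching n) : Finset (Finset (Fin n)) :=
  Finset.univ.image fun a => Finset.univ.filter fun b => M.SameRegion a b

/-- `numRegions M i` is the number `nᵢ(M)` of regions of `M` with exactly `i` boundary arcs
(for `i ≥ 1`). -/
def numRegions (M : PerfectMatching n) (i : ℕ) : ℕ :=
  (M.regions.filter fun R => R.card = i).card

/-- The potential `∑_{i > 1} (2 i - 3) nᵢ(M)`; a region has at most `n` boundary arcs. -/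
def potential (M : PerfectMatching n) : ℕ :=
  ∑ i ∈ Finset.Icc 2 n, (2 * i - 3) * M.numRegions i

/-- A maximal `k`-core: a `k`-core matching that maximizes the potential among all `k`-core
matchings, on any number of points. -/
def IsMaximalKCore (k : ℕ) (K : PerfectMatching n) : Prop :=
  K.IsKCore k ∧ ∀ (n' : ℕ) (K' : PerfectMatching n'), K'.IsKCore k → K'.potential ≤ K.potential

end PerfectMatching

/-- The number of perfect matchings of `n` points with `k` crossings. -/
noncomputable def numMatchings (k n : ℕ) : ℕ :=
  Nat.card {M : PerfectMatching n // M.crossings.card = k}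

/-- The number of perfect matchings of `n` points with `k` crossings whose core is one of the
maximal `k`-cores. -/
noncomputable def numMatchingsMaximalCore (k n : ℕ) : ℕ :=
  Nat.card {M : PerfectMatching n // M.crossings.card = k ∧ M.core.IsMaximalKCore k}

/-!
Upper bound: a perfect matching is determined by its set of closers, which a Dyck word encodes,
together with the number of chords that each closer overtakes, and these numbers add up to the
number of crossings. Hence there are at most `catalan m * (m + k - 1).choose k` perfect matchings
with `k` crossings on `2 * m` points.

Potential: in a `k`-core, each arc that is not the last one of its region, and also the last arc of
the root region, precedes the first point of a different crossing. Thus there are more than `n - k`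
regions on `n` points, which bounds the potential by `2 * k - 3`, and equality forces a single
region with `k` arcs. Counting the arcs of this region passed on the way to a point, modulo `k`,
gives crossing chords the same label; with only `k` crossings available, each label belongs to
exactly one pair of crossing chords. So the core consists of `k` crosses side by side, and there are
four ways to root it (one if `k = 1`).

Lower bound: inserting a cross, with small noncrossing matchings in three of the arcs between its
endpoints, at a point that lies under no crossing chord keeps the core maximal. Each of the `k`
insertions has about `2 * m` places to choose from, the order of insertion is lost to a factor `k!`,
and since `∑ a, catalan a / 4 ^ a = 2` the weight of the inserted crosses tends to `1` as they are
allowed to grow. This produces `4 ^ m * m ^ (k - 3 / 2) / (k! * √π)` matchings asymptotically, which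
is also the upper bound.
-/

namespace PerfectMatching

variable {n b : ℕ}

@[simp] theorem apply_apply (M : PerfectMatching n) (v : Fin n) : M.1 (M.1 v) = v := (M.2 v).1

theorem apply_ne (M : PerfectMatching n) (v : Fin n) : M.1 v ≠ v := (M.2 v).2

theorem injective (M : PerfectMatching n) : Function.Injective M.1 :=
  Function.LeftInverse.injective M.apply_apply

theorem mem_crossings {M : PerfectMatching n} {p : Fin n × Fin n} :
    p ∈ M.crossings ↔ p.1 < p.2 ∧ p.2 < M.1 p.1 ∧ M.1 p.1 < M.1 p.2 := by
  simp [crossings]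

theorem mem_crossingVertices {M : PerfectMatching n} {v : Fin n} :
    v ∈ M.crossingVertices ↔
      ∃ p ∈ M.crossings, v = p.1 ∨ v = M.1 p.1 ∨ v = p.2 ∨ v = M.1 p.2 := by
  simp [crossingVertices]

/-- The position of a point after a block of `b` points has been inserted into slot `i`, that is,
before the old point `i`. -/
def insertEquiv (n b i : ℕ) (hi : i ≤ n) : Fin n ⊕ Fin b ≃ Fin (n + b) where
  toFun := Sum.elim (fun x => ⟨if (x : ℕ) < i then x else x + b, by split <;> omega⟩)
    (fun y => ⟨i + y, by omega⟩)
  invFun z := if h : (z : ℕ) < i then .inl ⟨z, by omega⟩ else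
    if h' : (z : ℕ) < i + b then .inr ⟨z - i, by omega⟩ else .inl ⟨z - b, by omega⟩
  left_inv s := by
    rcases s with x | y
    · by_cases h : (x : ℕ) < i
      · simp [h]
      · have hge : ¬ (x : ℕ) + b < i := by omega
        simp [h, hge]
    · simp
  right_inv z := by
    by_cases h : (z : ℕ) < i
    · simp [h]
    · by_cases h' : (z : ℕ) < i + b
      · simp only [h, h', dite_true, dite_false, Sum.elim_inr, Fin.ext_iff]; omega
      · have hge : ¬ (z : ℕ) - b < i := by omega
        simp only [h, h', hge, dite_false, Sum.elim_inl, Fin.ext_iff, if_false]; omega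

section
variable {i : ℕ} (hi : i ≤ n)

theorem insertEquiv_inl_val (x : Fin n) :
    (insertEquiv n b i hi (.inl x) : ℕ) = if (x : ℕ) < i then (x : ℕ) else x + b := rfl

theorem insertEquiv_inr_val (y : Fin b) : (insertEquiv n b i hi (.inr y) : ℕ) = i + y := rfl

@[simp] theorem insertEquiv_inl_lt_inl (x y : Fin n) :
    insertEquiv n b i hi (.inl x) < insertEquiv n b i hi (.inl y) ↔ x < y := by
  simp only [Fin.lt_def, insertEquiv_inl_val]; split_ifs <;> omega

@[simp] theorem insertEquiv_inr_lt_inr (x y : Fin b) :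
    insertEquiv n b i hi (.inr x) < insertEquiv n b i hi (.inr y) ↔ x < y := by
  simp only [Fin.lt_def, insertEquiv_inr_val]; omega

@[simp] theorem insertEquiv_inl_lt_inr (x : Fin n) (y : Fin b) :
    insertEquiv n b i hi (.inl x) < insertEquiv n b i hi (.inr y) ↔ (x : ℕ) < i := by
  simp only [Fin.lt_def, insertEquiv_inr_val, insertEquiv_inl_val]; split_ifs <;> omega

@[simp] theorem insertEquiv_inr_lt_inl (x : Fin n) (y : Fin b) :
    insertEquiv n b i hi (.inr y) < insertEquiv n b i hi (.inl x) ↔ i ≤ (x : ℕ) := by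
  simp only [Fin.lt_def, insertEquiv_inr_val, insertEquiv_inl_val]; split_ifs <;> omega

@[simp] theorem insertEquiv_inl_le_inl (x y : Fin n) :
    insertEquiv n b i hi (.inl x) ≤ insertEquiv n b i hi (.inl y) ↔ x ≤ y := by
  simp only [← not_lt, insertEquiv_inl_lt_inl]

@[simp] theorem insertEquiv_inr_le_inr (x y : Fin b) :
    insertEquiv n b i hi (.inr x) ≤ insertEquiv n b i hi (.inr y) ↔ x ≤ y := by
  simp only [← not_lt, insertEquiv_inr_lt_inr]

@[simp] theorem insertEquiv_inl_le_inr (x : Fin n) (y : Fin b) :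
    insertEquiv n b i hi (.inl x) ≤ insertEquiv n b i hi (.inr y) ↔ (x : ℕ) < i := by
  rw [← not_lt, insertEquiv_inr_lt_inl, not_le]

@[simp] theorem insertEquiv_inr_le_inl (x : Fin n) (y : Fin b) :
    insertEquiv n b i hi (.inr y) ≤ insertEquiv n b i hi (.inl x) ↔ i ≤ (x : ℕ) := by
  rw [← not_lt, insertEquiv_inl_lt_inr, not_lt]

/-- The matching obtained from `M` by inserting the matching `B` contiguously into slot `i`. -/
def insertAt (M : PerfectMatching n) {i : ℕ} (hi : i ≤ n) (B : PerfectMatching b) :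
    PerfectMatching (n + b) :=
  ⟨fun z => insertEquiv n b i hi (Sum.map M.1 B.1 ((insertEquiv n b i hi).symm z)), fun z => by
    obtain ⟨s, rfl⟩ := (insertEquiv n b i hi).surjective z
    rcases s with x | y
    · simp [M.apply_apply, M.apply_ne]
    · simp [B.apply_apply, B.apply_ne]⟩

variable (M : PerfectMatching n) (B : PerfectMatching b)

@[simp] theorem insertAt_inl (x : Fin n) :
    (M.insertAt hi B).1 (insertEquiv n b i hi (.inl x)) = insertEquiv n b i hi (.inl (M.1 x)) := by
  simp [insertAt]

@[simp] theorem insertAt_inr (y : Fin b) :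
    (M.insertAt hi B).1 (insertEquiv n b i hi (.inr y)) = insertEquiv n b i hi (.inr (B.1 y)) := by
  simp [insertAt]

theorem insertAt_inj {M M' : PerfectMatching n} {B B' : PerfectMatching b}
    (h : M.insertAt hi B = M'.insertAt hi B') : M = M' ∧ B = B' := by
  constructor
  · refine Subtype.ext (funext fun x => ?_)
    have := congrFun (congrArg Subtype.val h) (insertEquiv n b i hi (.inl x))
    simpa using this
  · refine Subtype.ext (funext fun x => ?_)
    have := congrFun (congrArg Subtype.val h) (insertEquiv n b i hi (.inr x))
    simpa using this

theorem crossings_insertAt : (M.insertAt hi B).crossings =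
    (M.crossings.image fun p =>
      (insertEquiv n b i hi (.inl p.1), insertEquiv n b i hi (.inl p.2))) ∪
    (B.crossings.image fun p =>
      (insertEquiv n b i hi (.inr p.1), insertEquiv n b i hi (.inr p.2))) := by
  ext ⟨u, v⟩
  obtain ⟨s, rfl⟩ := (insertEquiv n b i hi).surjective u
  obtain ⟨t, rfl⟩ := (insertEquiv n b i hi).surjective v
  rcases s with x | x <;> rcases t with y | y <;>
    simp only [mem_crossings, insertAt_inl, insertAt_inr, insertEquiv_inl_lt_inl,
      insertEquiv_inl_lt_inr, insertEquiv_inr_lt_inl, insertEquiv_inr_lt_inr, Finset.mem_union,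
      Finset.mem_image, Prod.exists, Prod.mk.injEq, EmbeddingLike.apply_eq_iff_eq, Sum.inl.injEq,
      Sum.inr.injEq, reduceCtorEq, false_and, and_false, exists_false, or_false, false_or,
      exists_eq_right_right, exists_eq_right, iff_false, not_and]
  all_goals omega

theorem card_crossings_insertAt :
    (M.insertAt hi B).crossings.card = M.crossings.card + B.crossings.card := by
  rw [crossings_insertAt, Finset.card_union_of_disjoint, Finset.card_image_of_injective,
    Finset.card_image_of_injective]
  · rintro ⟨x, y⟩ ⟨x', y'⟩ h
    simpa using h
  · rintro ⟨x, y⟩ ⟨x', y'⟩ h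
    simpa using h
  · simp only [Finset.disjoint_left, Finset.mem_image]
    rintro _ ⟨p, -, rfl⟩ ⟨q, -, h⟩
    simp at h

@[simp] theorem mem_crossings_insertAt_inl {x y : Fin n} :
    (insertEquiv n b i hi (.inl x), insertEquiv n b i hi (.inl y)) ∈ (M.insertAt hi B).crossings ↔
      (x, y) ∈ M.crossings := by
  simp [mem_crossings]

@[simp] theorem mem_crossings_insertAt_inr {x y : Fin b} :
    (insertEquiv n b i hi (.inr x), insertEquiv n b i hi (.inr y)) ∈ (M.insertAt hi B).crossings ↔
      (x, y) ∈ B.crossings := by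
  simp [mem_crossings]

@[simp] theorem mem_crossingVertices_insertAt_inl {x : Fin n} :
    insertEquiv n b i hi (.inl x) ∈ (M.insertAt hi B).crossingVertices ↔
      x ∈ M.crossingVertices := by
  simp [mem_crossingVertices, crossings_insertAt, or_and_right, exists_or]

@[simp] theorem mem_crossingVertices_insertAt_inr {y : Fin b} :
    insertEquiv n b i hi (.inr y) ∈ (M.insertAt hi B).crossingVertices ↔
      y ∈ B.crossingVertices := by
  simp [mem_crossingVertices, crossings_insertAt, or_and_right, exists_or]

theorem forall_fin_insert {P : Fin (n + b) → Prop} :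
    (∀ z, P z) ↔ (∀ x, P (insertEquiv n b i hi (.inl x))) ∧
      ∀ y, P (insertEquiv n b i hi (.inr y)) := by
  rw [← (insertEquiv n b i hi).forall_congr_right]; simp

theorem exists_fin_insert {P : Fin (n + b) → Prop} :
    (∃ z, P z) ↔ (∃ x, P (insertEquiv n b i hi (.inl x))) ∨
      ∃ y, P (insertEquiv n b i hi (.inr y)) := by
  rw [← (insertEquiv n b i hi).exists_congr_right]; simp

end

theorem IsKCore.insertAt {k l : ℕ} {M : PerfectMatching n} {B : PerfectMatching b} {i : ℕ}
    (hi : i ≤ n) (hM : M.IsKCore k) (hB : B.IsKCore l) : (M.insertAt hi B).IsKCore (k + l) := by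
  refine ⟨?_, by rw [card_crossings_insertAt, hM.2, hB.2]⟩
  rw [forall_fin_insert hi]
  simp only [mem_crossingVertices_insertAt_inl, mem_crossingVertices_insertAt_inr]
  exact ⟨hM.1, hB.1⟩

/-- The points that are the second endpoint of their chord. -/
def closers (M : PerfectMatching n) : Finset (Fin n) := {v : Fin n | M.1 v < v}

/-- The first endpoints of the chords that are open just before the point `b`. -/
def openers (M : PerfectMatching n) (b : Fin n) : Finset (Fin n) := {v : Fin n | v < b ∧ b ≤ M.1 v}

/-- The number of chords that are open when the chord of the closer `b` is closed and that were
opened after it. -/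
def overtaken (M : PerfectMatching n) (b : Fin n) : ℕ := {v ∈ M.openers b | M.1 b < v}.card

theorem mem_closers {M : PerfectMatching n} {v : Fin n} : v ∈ M.closers ↔ M.1 v < v := by
  simp [closers]

theorem mem_openers {M : PerfectMatching n} {b v : Fin n} :
    v ∈ M.openers b ↔ v < b ∧ b ≤ M.1 v := by
  simp [openers]

theorem partner_mem_closers {M : PerfectMatching n} {v : Fin n} :
    M.1 v ∈ M.closers ↔ v ∉ M.closers := by
  have := M.apply_ne v
  simp only [mem_closers, apply_apply]
  omega

theorem image_closers (M : PerfectMatching n) : M.closers.image M.1 = M.closersᶜ := by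
  ext v
  rw [Finset.mem_image, Finset.mem_compl, ← partner_mem_closers]
  exact ⟨by rintro ⟨w, hw, rfl⟩; rwa [apply_apply], fun hv => ⟨M.1 v, hv, M.apply_apply v⟩⟩

theorem card_compl_closers (M : PerfectMatching n) : M.closersᶜ.card = M.closers.card := by
  rw [← image_closers, Finset.card_image_of_injective _ M.injective]

theorem two_mul_card_closers (M : PerfectMatching n) : 2 * M.closers.card = n := by
  rw [two_mul]
  nth_rw 2 [← card_compl_closers]
  rw [Finset.card_add_card_compl, Fintype.card_fin]

theorem overtaken_eq_zero {M : PerfectMatching n} {b : Fin n} (hb : b ∉ M.closers) :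
    M.overtaken b = 0 := by
  rw [mem_closers] at hb
  simp only [overtaken, Finset.card_eq_zero, Finset.filter_eq_empty_iff, mem_openers]
  intro v hv
  omega

theorem sum_overtaken (M : PerfectMatching n) :
    ∑ b ∈ M.closers, M.overtaken b = M.crossings.card := by
  rw [Finset.card_eq_sum_card_fiberwise (f := fun p => M.1 p.1) (t := M.closers)]
  · refine Finset.sum_congr rfl fun b _ => ?_
    refine Finset.card_bij (fun v _ => (M.1 b, v)) (fun v hv => ?_) (by simp) ?_
    · simp only [Finset.mem_filter, mem_openers] at hv
      have hne : M.1 v ≠ b := by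
        rintro rfl
        exact hv.2.ne (M.apply_apply v)
      simp only [Finset.mem_filter, mem_crossings, apply_apply, and_true]
      omega
    · rintro ⟨x, y⟩ hxy
      obtain ⟨hcross, hb⟩ := Finset.mem_filter.1 hxy
      obtain rfl : M.1 x = b := hb
      obtain ⟨h₁, h₂, h₃⟩ := mem_crossings.1 hcross
      refine ⟨y, ?_, by simp⟩
      simp only [Finset.mem_filter, mem_openers, apply_apply]
      exact ⟨⟨h₂, h₃.le⟩, h₁⟩
  · intro p hp
    obtain ⟨h₁, h₂, -⟩ := mem_crossings.1 hp
    rw [Finset.mem_coe, mem_closers, apply_apply]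
    exact h₁.trans h₂

theorem openers_subset_of_agree {M M' : PerfectMatching n} (hc : M.closers = M'.closers)
    {b : Fin n} (h : ∀ c ∈ M.closers, c < b → M.1 c = M'.1 c) : M.openers b ⊆ M'.openers b := by
  intro v hv
  rw [mem_openers] at hv ⊢
  refine ⟨hv.1, ?_⟩
  by_contra! hlt
  have hv' : v ∉ M'.closers := by rw [← hc, mem_closers]; omega
  have hclosed : M.1 (M'.1 v) = v := by
    rw [h _ (hc ▸ partner_mem_closers.2 hv') hlt, apply_apply]
  have : M.1 v = M'.1 v := by rw [← hclosed, apply_apply, hclosed]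
  omega

theorem eq_of_card_filter_lt_eq {α : Type*} [LinearOrder α] {s : Finset α} {x y : α}
    (hx : x ∈ s) (hy : y ∈ s) (h : {v ∈ s | x < v}.card = {v ∈ s | y < v}.card) : x = y := by
  have card_lt {x y : α} (hy : y ∈ s) (hxy : x < y) :
      {v ∈ s | y < v}.card < {v ∈ s | x < v}.card :=
    Finset.card_lt_card <| (Finset.ssubset_iff_of_subset
      (Finset.monotone_filter_right _ fun _ _ hv => hxy.trans hv)).2 ⟨y, by simp [hy, hxy]⟩
  rcases lt_trichotomy x y with hxy | hxy | hxy
  · exact absurd h (card_lt hy hxy).ne'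
  · exact hxy
  · exact absurd h (card_lt hx hxy).ne

theorem apply_eq_of_closers_of_overtaken {M M' : PerfectMatching n}
    (hc : M.closers = M'.closers) (ho : M.overtaken = M'.overtaken) (b : Fin n)
    (hb : b ∈ M.closers) : M.1 b = M'.1 b := by
  induction b using WellFoundedLT.induction with
  | ind b ih =>
  have hopen : M.openers b = M'.openers b :=
    (openers_subset_of_agree hc fun c hcM hcb => ih c hcb hcM).antisymm
      (openers_subset_of_agree hc.symm fun c hcM hcb => (ih c hcb (hc ▸ hcM)).symm)
  have partner_mem {N : PerfectMatching n} (hN : b ∈ N.closers) : N.1 b ∈ N.openers b := by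
    rw [mem_openers, apply_apply]
    exact ⟨mem_closers.1 hN, le_rfl⟩
  refine eq_of_card_filter_lt_eq (partner_mem hb) (hopen ▸ partner_mem (hc ▸ hb)) ?_
  nth_rw 2 [hopen]
  exact congrFun ho b

theorem eq_of_closers_of_overtaken {M M' : PerfectMatching n} (hc : M.closers = M'.closers)
    (ho : M.overtaken = M'.overtaken) : M = M' := by
  have agree := apply_eq_of_closers_of_overtaken hc ho
  refine Subtype.ext (funext fun v => ?_)
  by_cases hv : v ∈ M.closers
  · exact agree v hv
  · have h := agree (M.1 v) (partner_mem_closers.2 hv)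
    rw [apply_apply] at h
    conv_rhs => rw [h, apply_apply]

theorem count_ofFn {α : Type*} [DecidableEq α] (f : Fin n → α) (a : α) :
    (List.ofFn f).count a = ({v | a = f v} : Finset (Fin n)).card := by
  rw [← Multiset.coe_count, ← Fin.univ_val_map, Multiset.count_map]
  rfl

/-- The letter of the Dyck word of `M` at the point `v`: up at the first endpoint of a chord, down
at the second one. -/
def dyckStep (M : PerfectMatching n) (v : Fin n) : DyckStep :=
  if v ∈ M.closers then .D else .U

theorem D_eq_dyckStep {M : PerfectMatching n} {v : Fin n} :
    DyckStep.D = M.dyckStep v ↔ v ∈ M.closers := by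
  unfold dyckStep
  split_ifs <;> simp_all

theorem U_eq_dyckStep {M : PerfectMatching n} {v : Fin n} :
    DyckStep.U = M.dyckStep v ↔ v ∉ M.closers := by
  unfold dyckStep
  split_ifs <;> simp_all

theorem count_U_eq_count_D_ofFn_dyckStep (M : PerfectMatching n) :
    (List.ofFn M.dyckStep).count .U = (List.ofFn M.dyckStep).count .D := by
  simp only [count_ofFn, U_eq_dyckStep, D_eq_dyckStep, Finset.filter_univ_mem,
    ← M.card_compl_closers]
  congr 1
  ext v
  simp

theorem count_D_le_count_U_take_ofFn_dyckStep (M : PerfectMatching n) {i : ℕ} (hi : i ≤ n) :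
    ((List.ofFn M.dyckStep).take i).count .D ≤ ((List.ofFn M.dyckStep).take i).count .U := by
  rw [← Fin.ofFn_take_eq_take_ofFn hi, count_ofFn, count_ofFn]
  simp only [Fin.take_apply, U_eq_dyckStep, D_eq_dyckStep]
  refine Finset.card_le_card_of_surjOn
    (fun w => if h : (M.1 (w.castLE hi) : ℕ) < i then ⟨_, h⟩ else w) fun v hv => ?_
  simp only [Finset.coe_filter, Finset.mem_univ, true_and, Set.mem_ofPred_eq] at hv
  have hlt : (M.1 (v.castLE hi) : ℕ) < i := (Fin.lt_def.1 (mem_closers.1 hv)).trans v.2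
  refine ⟨⟨_, hlt⟩, ?_, ?_⟩
  · simp [partner_mem_closers, hv]
  · simp

/-- The Dyck word of a matching. -/
def dyckWord (M : PerfectMatching n) : DyckWord where
  toList := List.ofFn M.dyckStep
  count_U_eq_count_D := M.count_U_eq_count_D_ofFn_dyckStep
  count_D_le_count_U i := by
    rcases le_total i n with hi | hi
    · exact M.count_D_le_count_U_take_ofFn_dyckStep hi
    · rw [List.take_of_length_le (by rwa [List.length_ofFn])]
      exact M.count_U_eq_count_D_ofFn_dyckStep.ge

theorem closers_eq_of_dyckWord_eq {M M' : PerfectMatching n} (h : M.dyckWord = M'.dyckWord) :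
    M.closers = M'.closers := by
  have hstep : M.dyckStep = M'.dyckStep := List.ofFn_injective (congrArg DyckWord.toList h)
  ext v
  rw [← D_eq_dyckStep, ← D_eq_dyckStep, hstep]

theorem semilength_dyckWord {m : ℕ} (M : PerfectMatching (2 * m)) : M.dyckWord.semilength = m := by
  have h := M.dyckWord.two_mul_semilength_eq_length
  simp only [dyckWord, List.length_ofFn] at h ⊢
  omega

theorem card_filter_closers_le {m : ℕ} (k : ℕ) (s : Finset (Fin (2 * m))) (hs : s.card = m) :
    ({M | M.crossings.card = k ∧ M.closers = s} : Finset (PerfectMatching (2 * m))).card ≤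
      (m + k - 1).choose k := by
  have hcard := Finset.card_finsuppAntidiag_nat_eq_choose (s := s) k
  rw [hs] at hcard
  rw [← hcard]
  refine Finset.card_le_card_of_injOn (fun M => Finsupp.equivFunOnFinite.symm M.overtaken) ?_ ?_
  · intro M hM
    obtain ⟨-, rfl, rfl⟩ := Finset.mem_filter.1 hM
    rw [Finset.mem_coe, Finset.mem_finsuppAntidiag, ← sum_overtaken]
    refine ⟨rfl, fun b hb => ?_⟩
    by_contra hb'
    exact Finsupp.mem_support_iff.1 hb (overtaken_eq_zero hb')
  · intro M hM M' hM' h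
    exact eq_of_closers_of_overtaken ((Finset.mem_filter.1 hM).2.2.trans
      (Finset.mem_filter.1 hM').2.2.symm) (Finsupp.equivFunOnFinite.symm.injective h)

theorem numMatchings_le (k m : ℕ) :
    numMatchings k (2 * m) ≤ catalan m * (m + k - 1).choose k := by
  classical
  rw [numMatchings, Nat.card_eq_fintype_card, Fintype.card_subtype, mul_comm (catalan m)]
  refine (Finset.card_le_mul_card_image (f := fun M : PerfectMatching (2 * m) =>
    (⟨M.dyckWord, M.semilength_dyckWord⟩ : {p : DyckWord // p.semilength = m})) _ _ ?_).trans
    (Nat.mul_le_mul_left _ ((Finset.card_le_univ _).trans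
      (DyckWord.card_dyckWord_semilength_eq_catalan m).le))
  intro w hw
  obtain ⟨M₀, -, rfl⟩ := Finset.mem_image.1 hw
  refine le_trans (Finset.card_le_card fun M hM => ?_) (card_filter_closers_le k M₀.closers
    (by linarith [M₀.two_mul_card_closers]))
  simp only [Finset.mem_filter, Finset.mem_univ, true_and, Subtype.mk.injEq] at hM ⊢
  exact ⟨hM.1, closers_eq_of_dyckWord_eq hM.2⟩

theorem SameRegion.refl (M : PerfectMatching n) (a : Fin n) : M.SameRegion a a := fun _ _ => Iff.rfl

theorem SameRegion.symm {M : PerfectMatching n} {a b : Fin n} (h : M.SameRegion a b) :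
    M.SameRegion b a := fun v hv => (h v hv).symm

theorem SameRegion.trans {M : PerfectMatching n} {a b c : Fin n} (h : M.SameRegion a b)
    (h' : M.SameRegion b c) : M.SameRegion a c := fun v hv => (h v hv).trans (h' v hv)

/-- The region of the arc `a`, given as the set of its boundary arcs. -/
def region (M : PerfectMatching n) (a : Fin n) : Finset (Fin n) := {b | M.SameRegion a b}

theorem mem_region {M : PerfectMatching n} {a b : Fin n} : b ∈ M.region a ↔ M.SameRegion a b := by
  simp [region]

theorem self_mem_region (M : PerfectMatching n) (a : Fin n) : a ∈ M.region a :=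
  mem_region.2 (SameRegion.refl M a)

theorem region_eq_iff {M : PerfectMatching n} {a b : Fin n} :
    M.region a = M.region b ↔ M.SameRegion a b := by
  refine ⟨fun h => ?_, fun h => ?_⟩
  · rw [← mem_region, h]
    exact M.self_mem_region b
  · ext c
    rw [mem_region, mem_region]
    exact ⟨h.symm.trans, h.trans⟩

theorem mem_regions {M : PerfectMatching n} {R : Finset (Fin n)} :
    R ∈ M.regions ↔ ∃ a, M.region a = R := by
  simp [regions, region]

theorem region_mem_regions (M : PerfectMatching n) (a : Fin n) : M.region a ∈ M.regions :=
  mem_regions.2 ⟨a, rfl⟩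

theorem card_region_pos (M : PerfectMatching n) (a : Fin n) : 0 < (M.region a).card :=
  Finset.card_pos.2 ⟨a, M.self_mem_region a⟩

theorem sum_card_regions (M : PerfectMatching n) : ∑ R ∈ M.regions, R.card = n := by
  conv_rhs => rw [← Fintype.card_fin n, ← Finset.card_univ,
    Finset.card_eq_sum_card_fiberwise fun a _ => M.region_mem_regions a]
  refine Finset.sum_congr rfl fun R hR => ?_
  obtain ⟨a, rfl⟩ := mem_regions.1 hR
  congr 1
  ext b
  rw [mem_region, Finset.mem_filter_univ, region_eq_iff]
  exact ⟨SameRegion.symm, SameRegion.symm⟩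

/-- The regions with at least two boundary arcs, which are those that contribute to the
potential. -/
def bigRegions (M : PerfectMatching n) : Finset (Finset (Fin n)) := {R ∈ M.regions | 2 ≤ R.card}

theorem region_mem_bigRegions {M : PerfectMatching n} {a : Fin n} :
    M.region a ∈ M.bigRegions ↔ 2 ≤ (M.region a).card := by
  simp [bigRegions, region_mem_regions]

theorem potential_eq_sum (M : PerfectMatching n) :
    M.potential = ∑ R ∈ M.bigRegions, (2 * R.card - 3) := by
  rw [potential, ← Finset.sum_fiberwise_of_maps_to (s := M.bigRegions) (t := Finset.Icc 2 n)
    (g := Finset.card)]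
  · refine Finset.sum_congr rfl fun i hi => ?_
    rw [Finset.sum_congr rfl fun R hR => by rw [(Finset.mem_filter.1 hR).2], Finset.sum_const,
      smul_eq_mul, mul_comm, numRegions, bigRegions, Finset.filter_filter]
    congr 2
    refine Finset.filter_congr fun R _ => (and_iff_right_of_imp ?_).symm
    rintro rfl
    exact (Finset.mem_Icc.1 hi).1
  · intro R hR
    exact Finset.mem_Icc.2 ⟨(Finset.mem_filter.1 hR).2, by simpa using Finset.card_le_univ R⟩

theorem potential_add (M : PerfectMatching n) :
    M.potential + M.bigRegions.card + 2 * M.regions.card = 2 * n := by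
  have hbig : M.potential + M.bigRegions.card = ∑ R ∈ M.bigRegions, 2 * (R.card - 1) := by
    rw [potential_eq_sum, Finset.card_eq_sum_ones, ← Finset.sum_add_distrib]
    refine Finset.sum_congr rfl fun R hR => ?_
    have := (Finset.mem_filter.1 hR).2
    omega
  have hall : ∑ R ∈ M.bigRegions, 2 * (R.card - 1) = ∑ R ∈ M.regions, 2 * (R.card - 1) := by
    refine Finset.sum_subset (Finset.filter_subset _ _) fun R hR hR' => ?_
    have : ¬ 2 ≤ R.card := fun h => hR' (Finset.mem_filter.2 ⟨hR, h⟩)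
    omega
  rw [hbig, hall, Finset.card_eq_sum_ones, Finset.mul_sum, ← Finset.sum_add_distrib]
  conv_rhs => rw [← M.sum_card_regions, Finset.mul_sum]
  refine Finset.sum_congr rfl fun R hR => ?_
  obtain ⟨a, rfl⟩ := mem_regions.1 hR
  have := M.card_region_pos a
  omega

theorem le_potential {M : PerfectMatching n} {S : Finset (Fin n)} {k : ℕ} (hS : k ≤ S.card)
    (h : ∀ a ∈ S, ∀ b ∈ S, M.SameRegion a b) : 2 * k - 3 ≤ M.potential := by
  rcases lt_or_ge k 2 with hk | hk
  · omega
  obtain ⟨a, ha⟩ : S.Nonempty := Finset.card_pos.1 (by omega)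
  have hle : S.card ≤ (M.region a).card :=
    Finset.card_le_card fun b hb => mem_region.2 (h a ha b hb)
  have hmem : M.region a ∈ M.bigRegions := region_mem_bigRegions.2 (by omega)
  calc 2 * k - 3 ≤ 2 * (M.region a).card - 3 := by omega
    _ ≤ ∑ R ∈ M.bigRegions, (2 * R.card - 3) :=
      Finset.single_le_sum (f := fun R : Finset (Fin n) => 2 * R.card - 3)
        (fun _ _ => Nat.zero_le _) hmem
    _ = M.potential := M.potential_eq_sum.symm

/-- The arcs that are not the last one of their region, counting from the root. -/
def nonlast (M : PerfectMatching n) : Finset (Fin n) := {a | ∃ b, a < b ∧ M.SameRegion a b}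

theorem mem_nonlast {M : PerfectMatching n} {a : Fin n} :
    a ∈ M.nonlast ↔ ∃ b, a < b ∧ M.SameRegion a b := by
  simp [nonlast]

theorem exists_last (M : PerfectMatching n) (a : Fin n) :
    ∃ z, z ∉ M.nonlast ∧ M.SameRegion a z := by
  have hne : (M.region a).Nonempty := ⟨a, M.self_mem_region a⟩
  have hlast : M.SameRegion a ((M.region a).max' hne) := mem_region.1 (Finset.max'_mem _ hne)
  refine ⟨(M.region a).max' hne, fun hz => ?_, hlast⟩
  obtain ⟨b, hlt, hb⟩ := mem_nonlast.1 hz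
  exact hlt.not_ge (Finset.le_max' _ _ (mem_region.2 (hlast.trans hb)))

theorem card_compl_nonlast (M : PerfectMatching n) : M.nonlastᶜ.card = M.regions.card := by
  refine Finset.card_bij (fun a _ => M.region a) (fun a _ => M.region_mem_regions a) ?_ ?_
  · intro a ha b hb h
    rw [region_eq_iff] at h
    rw [Finset.mem_compl, mem_nonlast] at ha hb
    push Not at ha hb
    exact le_antisymm (not_lt.1 fun hlt => hb a hlt h.symm) (not_lt.1 fun hlt => ha b hlt h)
  · intro R hR
    obtain ⟨a, rfl⟩ := mem_regions.1 hR
    obtain ⟨z, hz, haz⟩ := M.exists_last a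
    exact ⟨z, Finset.mem_compl.2 hz, (region_eq_iff.2 haz).symm⟩

/-- The points `v` with `a ≤ v < c` are matched among themselves. -/
def ClosedIco (M : PerfectMatching n) (a c : ℕ) : Prop :=
  ∀ v : Fin n, a ≤ v → (v : ℕ) < c → a ≤ (M.1 v : ℕ) ∧ (M.1 v : ℕ) < c

theorem SameRegion.closedIco {M : PerfectMatching n} {a b : Fin n} (h : M.SameRegion a b) :
    M.ClosedIco a b := by
  intro v hav hvb
  have hv := h v
  have hpartner := h (M.1 v)
  rw [apply_apply] at hpartner
  have := M.apply_ne v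
  omega

theorem closedIco_of_sameRegion_zero {M : PerfectMatching n} {o z : Fin n} (ho : (o : ℕ) = 0)
    (h : M.SameRegion o z) : M.ClosedIco z n := by
  intro v hzv _
  refine ⟨?_, (M.1 v).is_lt⟩
  have hpartner := h (M.1 v)
  rw [apply_apply] at hpartner
  omega

theorem ClosedIco.exists_mem_crossings {M : PerfectMatching n} {a : Fin n} {c : ℕ}
    (h : M.ClosedIco a c) (hac : (a : ℕ) < c) (ha : a ∈ M.crossingVertices) :
    ∃ q, (a, q) ∈ M.crossings := by
  obtain ⟨⟨p, q⟩, hpq, hv⟩ := mem_crossingVertices.1 ha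
  have hlt := mem_crossings.1 hpq
  have hself := h a le_rfl hac
  have hp := h (M.1 p)
  dsimp only at hlt hv
  rcases hv with rfl | rfl | rfl | rfl
  · exact ⟨q, hpq⟩
  all_goals
    simp only [apply_apply] at hself hp
    omega

/-- The first points of the crossings. -/
def firsts (M : PerfectMatching n) : Finset (Fin n) := M.crossings.image Prod.fst

theorem mem_firsts {M : PerfectMatching n} {a : Fin n} :
    a ∈ M.firsts ↔ ∃ q, (a, q) ∈ M.crossings := by
  simp [firsts]

theorem insert_nonlast_subset_firsts {M : PerfectMatching n} (hM : ∀ v, v ∈ M.crossingVertices)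
    {o z : Fin n} (ho : (o : ℕ) = 0) (hz : M.SameRegion o z) :
    insert z M.nonlast ⊆ M.firsts := by
  intro a ha
  rw [mem_firsts]
  rcases Finset.mem_insert.1 ha with rfl | ha
  · exact (closedIco_of_sameRegion_zero ho hz).exists_mem_crossings a.is_lt (hM _)
  · obtain ⟨b, hab, hb⟩ := mem_nonlast.1 ha
    exact hb.closedIco.exists_mem_crossings hab (hM _)

section IsKCore

variable {k : ℕ} {M : PerfectMatching n} (hM : M.IsKCore k) (hk : 1 ≤ k)

include hM

theorem IsKCore.add_four_le {a : Fin n} {c : ℕ} (h : M.ClosedIco a c) (hac : (a : ℕ) < c) :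
    (a : ℕ) + 4 ≤ c := by
  obtain ⟨q, hq⟩ := h.exists_mem_crossings hac (hM.1 a)
  have hlt := mem_crossings.1 hq
  have hq := h q
  have ha := h a
  dsimp only at hlt
  omega

include hk

theorem IsKCore.pos : 0 < n := by
  obtain ⟨p, -⟩ : M.crossings.Nonempty := Finset.card_pos.1 (by rw [hM.2]; omega)
  exact Fin.pos p.1

theorem IsKCore.lt_add_card_regions : n < k + M.regions.card := by
  obtain ⟨z, hz, hsame⟩ := M.exists_last ⟨0, hM.pos hk⟩
  have hfirsts : M.nonlast.card + 1 ≤ k := by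
    rw [← Finset.card_insert_of_notMem hz, ← hM.2]
    exact (Finset.card_le_card (insert_nonlast_subset_firsts hM.1 rfl hsame)).trans
      Finset.card_image_le
  have hcompl := Finset.card_add_card_compl M.nonlast
  rw [card_compl_nonlast, Fintype.card_fin] at hcompl
  omega

theorem IsKCore.potential_le : M.potential ≤ 2 * k - 3 := by
  have hlt := hM.lt_add_card_regions hk
  have hadd := M.potential_add
  rcases M.bigRegions.eq_empty_or_nonempty with hempty | hne
  · simp [potential_eq_sum, hempty]
  · have := hne.card_pos
    omega

theorem IsKCore.isMaximalKCore (hpot : 2 * k - 3 ≤ M.potential) : M.IsMaximalKCore k :=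
  ⟨hM, fun _ _ hK' => (hK'.potential_le hk).trans hpot⟩

theorem IsKCore.exists_card_region_eq (hpot : 2 * k - 3 ≤ M.potential) :
    ∃ a, (M.region a).card = k := by
  have hlt := hM.lt_add_card_regions hk
  have hadd := M.potential_add
  have hle := hM.potential_le hk
  rcases eq_or_lt_of_le hk with rfl | hk'
  · have hempty : M.bigRegions = ∅ := Finset.card_eq_zero.1 (by omega)
    refine ⟨⟨0, hM.pos le_rfl⟩, le_antisymm ?_ (M.card_region_pos _)⟩
    rw [← not_lt]
    exact fun h => Finset.notMem_empty _ (hempty ▸ region_mem_bigRegions.2 h)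
  · obtain ⟨R, hR⟩ : ∃ R, M.bigRegions = {R} := Finset.card_eq_one.1 (by omega)
    obtain ⟨hRmem, hcard⟩ := Finset.mem_filter.1 (hR ▸ Finset.mem_singleton_self R)
    obtain ⟨a, rfl⟩ := mem_regions.1 hRmem
    have hpotR := M.potential_eq_sum
    rw [hR, Finset.sum_singleton] at hpotR
    exact ⟨a, by omega⟩

end IsKCore

/-- Slot `i` lies under a chord involved in a crossing. -/
def IsCovered (M : PerfectMatching n) (i : ℕ) : Prop :=
  ∃ v ∈ M.crossingVertices, (v : ℕ) < i ∧ i ≤ (M.1 v : ℕ)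

instance (M : PerfectMatching n) (i : ℕ) : Decidable (M.IsCovered i) := by
  unfold IsCovered
  infer_instance

theorem isCovered_val {M : PerfectMatching n} {a : Fin n} :
    M.IsCovered a ↔ ∃ v ∈ M.crossingVertices, v < a ∧ a ≤ M.1 v := Iff.rfl

theorem not_isCovered_zero (M : PerfectMatching n) : ¬ M.IsCovered 0 := by
  simp [IsCovered]

/-- The points lying under a chord involved in a crossing. -/
def covered (M : PerfectMatching n) : Finset (Fin n) := {a : Fin n | M.IsCovered a}

theorem mem_covered {M : PerfectMatching n} {a : Fin n} : a ∈ M.covered ↔ M.IsCovered a := by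
  simp [covered]

/-- The points of chords involved in a crossing that do not lie under such a chord. In the core,
the arcs ending at these points all bound the same region. -/
def exposed (M : PerfectMatching n) : Finset (Fin n) := {a ∈ M.crossingVertices | ¬ M.IsCovered a}

theorem mem_exposed {M : PerfectMatching n} {a : Fin n} :
    a ∈ M.exposed ↔ a ∈ M.crossingVertices ∧ ¬ M.IsCovered a := by
  simp [exposed]

section insertAt

variable {i : ℕ} (hi : i ≤ n) (M : PerfectMatching n) (B : PerfectMatching b)

theorem isCovered_insertAt_inl (x : Fin n) :
    (M.insertAt hi B).IsCovered (insertEquiv n b i hi (.inl x)) ↔ M.IsCovered x := by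
  rw [isCovered_val, isCovered_val, exists_fin_insert hi]
  simp only [mem_crossingVertices_insertAt_inl, insertEquiv_inl_lt_inl, insertAt_inl,
    insertEquiv_inl_le_inl, mem_crossingVertices_insertAt_inr, insertEquiv_inr_lt_inl, insertAt_inr,
    insertEquiv_inl_le_inr, or_iff_left_iff_imp]
  rintro ⟨y, -, hle, hlt⟩
  omega

theorem isCovered_insertAt_inr (y : Fin b) :
    (M.insertAt hi B).IsCovered (insertEquiv n b i hi (.inr y)) ↔
      M.IsCovered i ∨ B.IsCovered y := by
  rw [isCovered_val, isCovered_val, exists_fin_insert hi]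
  simp [IsCovered]

theorem card_covered_insertAt_le :
    (M.insertAt hi B).covered.card ≤ M.covered.card + b := by
  have hsub : (M.insertAt hi B).covered ⊆
      (M.covered.disjSum Finset.univ).map (insertEquiv n b i hi).toEmbedding := by
    intro z
    revert z
    rw [forall_fin_insert hi]
    simp [mem_covered, isCovered_insertAt_inl]
  simpa using Finset.card_le_card hsub

theorem card_exposed_insertAt (hM : ¬ M.IsCovered i) :
    (M.insertAt hi B).exposed.card = M.exposed.card + B.exposed.card := by
  have h : (M.insertAt hi B).exposed =
      (M.exposed.disjSum B.exposed).map (insertEquiv n b i hi).toEmbedding := by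
    ext z
    revert z
    rw [forall_fin_insert hi]
    simp [mem_exposed, isCovered_insertAt_inl, isCovered_insertAt_inr, hM]
  rw [h, Finset.card_map, Finset.card_disjSum]

end insertAt

/-- The increasing enumeration of the points of the core. -/
def corePoint (M : PerfectMatching n) (v : Fin M.crossingVertices.card) : Fin n :=
  M.crossingVertices.orderIsoOfFin rfl v

theorem corePoint_mem (M : PerfectMatching n) (v : Fin M.crossingVertices.card) :
    M.corePoint v ∈ M.crossingVertices := (M.crossingVertices.orderIsoOfFin rfl v).2

theorem exists_corePoint_eq {M : PerfectMatching n} {v : Fin n} (hv : v ∈ M.crossingVertices) :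
    ∃ w, M.corePoint w = v :=
  ⟨(M.crossingVertices.orderIsoOfFin rfl).symm ⟨v, hv⟩, by simp [corePoint]⟩

@[simp] theorem corePoint_lt_corePoint (M : PerfectMatching n) {v w : Fin M.crossingVertices.card} :
    M.corePoint v < M.corePoint w ↔ v < w := by
  unfold corePoint
  rw [Subtype.coe_lt_coe, OrderIso.lt_iff_lt]

@[simp] theorem corePoint_le_corePoint (M : PerfectMatching n) {v w : Fin M.crossingVertices.card} :
    M.corePoint v ≤ M.corePoint w ↔ v ≤ w := by
  rw [← not_lt, corePoint_lt_corePoint, not_lt]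

theorem corePoint_injective (M : PerfectMatching n) : Function.Injective M.corePoint :=
  Subtype.val_injective.comp (OrderIso.injective _)

@[simp] theorem corePoint_core (M : PerfectMatching n) (v : Fin M.crossingVertices.card) :
    M.corePoint (M.core.1 v) = M.1 (M.corePoint v) := by
  simp [corePoint, core]

theorem mem_crossings_core {M : PerfectMatching n} {v w : Fin M.crossingVertices.card} :
    (v, w) ∈ M.core.crossings ↔ (M.corePoint v, M.corePoint w) ∈ M.crossings := by
  simp only [mem_crossings, ← corePoint_core, corePoint_lt_corePoint]

theorem exists_corePoint_of_mem_crossings {M : PerfectMatching n} {p : Fin n × Fin n}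
    (hp : p ∈ M.crossings) : ∃ q ∈ M.core.crossings, (M.corePoint q.1, M.corePoint q.2) = p := by
  obtain ⟨v, hv⟩ := exists_corePoint_eq (mem_crossingVertices.2 ⟨p, hp, Or.inl rfl⟩)
  obtain ⟨w, hw⟩ :=
    exists_corePoint_eq (mem_crossingVertices.2 ⟨p, hp, Or.inr (Or.inr (Or.inl rfl))⟩)
  refine ⟨(v, w), mem_crossings_core.2 ?_, by rw [hv, hw]⟩
  rwa [hv, hw]

theorem card_crossings_core (M : PerfectMatching n) :
    M.core.crossings.card = M.crossings.card :=
  Finset.card_bij (fun p _ => (M.corePoint p.1, M.corePoint p.2))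
    (fun _ hp => mem_crossings_core.1 hp)
    (fun _ _ _ _ h => Prod.ext (M.corePoint_injective (Prod.ext_iff.1 h).1)
      (M.corePoint_injective (Prod.ext_iff.1 h).2))
    fun _ hp => by simpa using exists_corePoint_of_mem_crossings hp

theorem core_isKCore (M : PerfectMatching n) : M.core.IsKCore M.crossings.card := by
  refine ⟨fun v => ?_, M.card_crossings_core⟩
  obtain ⟨p, hp, hv⟩ := mem_crossingVertices.1 (M.corePoint_mem v)
  obtain ⟨q, hq, rfl⟩ := exists_corePoint_of_mem_crossings hp
  simp only [← corePoint_core, M.corePoint_injective.eq_iff] at hv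
  exact mem_crossingVertices.2 ⟨q, hq, hv⟩

theorem sameRegion_core_of_exposed {M : PerfectMatching n} {a b : Fin M.crossingVertices.card}
    (ha : M.corePoint a ∈ M.exposed) (hb : M.corePoint b ∈ M.exposed) :
    M.core.SameRegion a b := by
  have not_under {c} (hc : M.corePoint c ∈ M.exposed) (v) : ¬ (v < c ∧ c ≤ M.core.1 v) := by
    intro hv
    refine (mem_exposed.1 hc).2 (isCovered_val.2 ⟨M.corePoint v, M.corePoint_mem v, ?_⟩)
    rwa [← corePoint_core, corePoint_lt_corePoint, corePoint_le_corePoint]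
  intro v _
  simp only [not_under ha v, not_under hb v]

theorem isMaximalKCore_core_of_exposed {M : PerfectMatching n} {k : ℕ} (hk : 1 ≤ k)
    (hM : M.crossings.card = k) (hE : k ≤ M.exposed.card) : M.core.IsMaximalKCore k := by
  refine (hM ▸ M.core_isKCore).isMaximalKCore hk <|
    le_potential (S := {v | M.corePoint v ∈ M.exposed}) ?_ fun a ha b hb =>
      sameRegion_core_of_exposed (by simpa using ha) (by simpa using hb)
  refine hE.trans (Finset.card_le_card_of_surjOn M.corePoint fun v hv => ?_)
  obtain ⟨w, rfl⟩ := exists_corePoint_eq (mem_exposed.1 hv).1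
  exact ⟨w, by simpa using hv, rfl⟩

theorem numMatchingsMaximalCore_le (k n : ℕ) : numMatchingsMaximalCore k n ≤ numMatchings k n := by
  unfold numMatchingsMaximalCore numMatchings
  exact Nat.card_le_card_of_injective (fun M => ⟨M.1, M.2.1⟩) fun M M' h => by
    simpa [Subtype.ext_iff] using h

/-- A labelling of the points by all elements of `ι` such that crossing chords carry the same label.
If a core has as many crossings as there are labels, then each label belongs to a single pair of
crossing chords. -/
structure IsCrossingLabelling {ι : Type*} (M : PerfectMatching n) (f : Fin n → ι) : Prop where
  apply_partner : ∀ v, f (M.1 v) = f v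
  apply_crossing : ∀ p ∈ M.crossings, f p.1 = f p.2
  surjective : Function.Surjective f

namespace IsCrossingLabelling

variable {ι : Type*} [Fintype ι] {M M' : PerfectMatching n} {f : Fin n → ι}
  (hf : M.IsCrossingLabelling f) (hM : M.IsKCore (Fintype.card ι))

include hf

omit [Fintype ι] in
theorem exists_crossing (hM : ∀ v, v ∈ M.crossingVertices) (v : Fin n) : ∃ p ∈ M.crossings,
    f p.1 = f v ∧ (v = p.1 ∨ v = p.2 ∨ v = M.1 p.1 ∨ v = M.1 p.2) := by
  obtain ⟨p, hp, hv⟩ := mem_crossingVertices.1 (hM v)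
  have := hf.apply_crossing p hp
  refine ⟨p, hp, ?_, by tauto⟩
  rcases hv with rfl | rfl | rfl | rfl <;> simp [hf.apply_partner, this]

include hM

theorem injOn_crossings : Set.InjOn (fun p : Fin n × Fin n => f p.1) M.crossings := by
  intro p hp q hq h
  refine Finset.inj_on_of_surj_on_of_card_le (t := Finset.univ) (fun p _ => f p.1)
    (fun _ _ => Finset.mem_univ _) (fun x _ => ?_) (by rw [Finset.card_univ, hM.2]) hp hq h
  obtain ⟨v, rfl⟩ := hf.surjective x
  obtain ⟨p, hp, hpv, -⟩ := hf.exists_crossing hM.1 v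
  exact ⟨p, hp, hpv⟩

theorem sort_fiber [DecidableEq ι] {p : Fin n × Fin n} (hp : p ∈ M.crossings) :
    ({v | f v = f p.1} : Finset (Fin n)).sort = [p.1, p.2, M.1 p.1, M.1 p.2] := by
  have hfiber : ({v | f v = f p.1} : Finset (Fin n)) = [p.1, p.2, M.1 p.1, M.1 p.2].toFinset := by
    ext v
    simp only [Finset.mem_filter_univ, List.mem_toFinset, List.mem_cons, List.not_mem_nil, or_false]
    constructor
    · intro hv
      obtain ⟨q, hq, hqv, hmem⟩ := hf.exists_crossing hM.1 v
      obtain rfl : q = p := hf.injOn_crossings hM hq hp (hqv.trans hv)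
      exact hmem
    · have := hf.apply_crossing p hp
      rintro (rfl | rfl | rfl | rfl) <;> simp [hf.apply_partner, this]
  obtain ⟨h₁, h₂, h₃⟩ := mem_crossings.1 hp
  have hsorted : [p.1, p.2, M.1 p.1, M.1 p.2].SortedLT := by
    simp [List.sortedLT_iff_pairwise, h₁, h₂, h₃, h₁.trans h₂, h₂.trans h₃, (h₁.trans h₂).trans h₃]
  rw [hfiber, (List.toFinset_sort _ hsorted.nodup).2 hsorted.sortedLE.pairwise]

theorem card_fiber [DecidableEq ι] (x : ι) : ({v | f v = x} : Finset (Fin n)).card = 4 := by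
  obtain ⟨v, rfl⟩ := hf.surjective x
  obtain ⟨p, hp, hpv, -⟩ := hf.exists_crossing hM.1 v
  rw [← hpv, ← Finset.length_sort (· ≤ ·), hf.sort_fiber hM hp]
  rfl

theorem eq_four_mul_card : n = 4 * Fintype.card ι := by
  classical
  conv_lhs => rw [← Fintype.card_fin n, ← Finset.card_univ,
    Finset.card_eq_sum_card_fiberwise (f := f) (t := Finset.univ) (by simp)]
  simp only [hf.card_fiber hM, Finset.sum_const, Finset.card_univ, smul_eq_mul, mul_comm]

omit hM in
theorem unique (hM : M.IsKCore (Fintype.card ι)) (hf' : M'.IsCrossingLabelling f)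
    (hM' : M'.IsKCore (Fintype.card ι)) : M = M' := by
  classical
  refine Subtype.ext (funext fun v => ?_)
  obtain ⟨p, hp, hpv, hmem⟩ := hf.exists_crossing hM.1 v
  obtain ⟨q, hq, hqv, -⟩ := hf'.exists_crossing hM'.1 v
  have hsort := hf.sort_fiber hM hp
  rw [hpv, ← hqv, hf'.sort_fiber hM' hq] at hsort
  simp only [List.cons.injEq, and_true] at hsort
  obtain ⟨h₁, h₂, h₃, h₄⟩ := hsort
  rcases hmem with rfl | rfl | rfl | rfl
  · rw [← h₃, h₁]
  · rw [← h₄, h₂]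
  · rw [apply_apply, ← h₃, apply_apply, h₁]
  · rw [apply_apply, ← h₄, apply_apply, h₂]

end IsCrossingLabelling

/-- The number of arcs of the region of `a` up to and including the arc `v`. -/
def arcRank (M : PerfectMatching n) (a v : Fin n) : ℕ := {b ∈ M.region a | b ≤ v}.card

theorem monotone_arcRank (M : PerfectMatching n) (a : Fin n) : Monotone (M.arcRank a) :=
  fun _ _ h => Finset.card_le_card (Finset.monotone_filter_right _ fun _ _ hb => hb.trans h)

theorem arcRank_le (M : PerfectMatching n) (a v : Fin n) : M.arcRank a v ≤ (M.region a).card :=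
  Finset.card_filter_le _ _

theorem arcRank_pos {M : PerfectMatching n} {a v : Fin n} (hv : v ∈ M.region a) :
    0 < M.arcRank a v :=
  Finset.card_pos.2 ⟨v, Finset.mem_filter.2 ⟨hv, le_rfl⟩⟩

theorem arcRank_injOn (M : PerfectMatching n) (a : Fin n) :
    Set.InjOn (M.arcRank a) (M.region a) := by
  refine StrictMonoOn.injOn fun v _ w hw hvw => Finset.card_lt_card ?_
  refine (Finset.ssubset_iff_of_subset
    (Finset.monotone_filter_right _ fun _ _ hb => hb.trans hvw.le)).2 ⟨w, ?_⟩
  simpa [hvw] using hw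

theorem exists_arcRank_eq_card (M : PerfectMatching n) (a : Fin n) :
    ∃ v, M.arcRank a v = (M.region a).card := by
  have hne : (M.region a).Nonempty := ⟨a, M.self_mem_region a⟩
  exact ⟨(M.region a).max' hne,
    congrArg Finset.card (Finset.filter_true_of_mem fun b hb => Finset.le_max' _ b hb)⟩

-- A chord has all arcs of a region on one side.
theorem arcRank_partner (M : PerfectMatching n) (a : Fin n) {v : Fin n} (hv : v < M.1 v) :
    M.arcRank a (M.1 v) = M.arcRank a v ∨
      M.arcRank a v = 0 ∧ M.arcRank a (M.1 v) = (M.region a).card := by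
  by_cases ha : v < a ∧ a ≤ M.1 v
  · right
    have hside : ∀ b ∈ M.region a, v < b ∧ b ≤ M.1 v := fun b hb => (mem_region.1 hb v hv).1 ha
    refine ⟨?_, congrArg Finset.card (Finset.filter_true_of_mem fun b hb => (hside b hb).2)⟩
    exact Finset.card_eq_zero.2 (Finset.filter_eq_empty_iff.2 fun b hb => (hside b hb).1.not_ge)
  · left
    refine congrArg Finset.card (Finset.filter_congr fun b hb => ?_)
    have := mt (mem_region.1 hb v hv).2 ha
    constructor <;> intro <;> omega

theorem apply_le_iff_lt_card_of_monotone {r : Fin n → ℕ} (hr : Monotone r) (v : Fin n) (j : ℕ) :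
    r v ≤ j ↔ (v : ℕ) < ({w | r w ≤ j} : Finset (Fin n)).card := by
  constructor
  · intro h
    rw [← Nat.succ_le_iff, Nat.succ_eq_add_one, ← Fin.card_Iic]
    exact Finset.card_le_card fun w hw => by simpa using (hr (Finset.mem_Iic.1 hw)).trans h
  · contrapose!
    intro h
    rw [← Fin.card_Iio]
    refine Finset.card_le_card fun w hw => Finset.mem_Iio.2 (not_le.1 fun hvw => ?_)
    exact ((h.trans_le (hr hvw)).not_ge (by simpa using hw))

section bigRegion

variable {k : ℕ} {M : PerfectMatching n} {a : Fin n}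

theorem arcRank_isCrossingLabelling (hk : 1 ≤ k) (ha : (M.region a).card = k) :
    M.IsCrossingLabelling fun v => (M.arcRank a v : ZMod k) := by
  have : NeZero k := ⟨by omega⟩
  have apply_partner_of_lt {v} (hv : v < M.1 v) :
      (M.arcRank a (M.1 v) : ZMod k) = M.arcRank a v := by
    rcases M.arcRank_partner a hv with h | ⟨h₁, h₂⟩
    · rw [h]
    · rw [h₁, h₂, ha, ZMod.natCast_self, Nat.cast_zero]
  have apply_partner (v) : (M.arcRank a (M.1 v) : ZMod k) = M.arcRank a v := by
    rcases lt_or_gt_of_ne (M.apply_ne v) with hv | hv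
    · simpa using (apply_partner_of_lt (v := M.1 v) (by simpa using hv)).symm
    · exact apply_partner_of_lt hv
  refine ⟨apply_partner, fun p hp => ?_, ?_⟩
  · obtain ⟨h₁, h₂, h₃⟩ := mem_crossings.1 hp
    have r₁ := M.monotone_arcRank a h₁.le
    have r₂ := M.monotone_arcRank a h₂.le
    have r₃ := M.monotone_arcRank a h₃.le
    rcases M.arcRank_partner a (h₁.trans h₂) with h | ⟨-, h⟩
    · rw [show M.arcRank a p.1 = M.arcRank a p.2 by omega]
    · have := M.arcRank_le a (M.1 p.2)
      rw [← apply_partner, ← apply_partner p.2,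
        show M.arcRank a (M.1 p.1) = M.arcRank a (M.1 p.2) by omega]
  · have hsurj := Finset.surjOn_of_injOn_of_card_le (s := M.region a) (t := Finset.univ)
      (fun v => (M.arcRank a v : ZMod k)) (by simp [Set.MapsTo]) ?_ (by simp [ha, ZMod.card])
    · exact fun x => (hsurj (Finset.mem_univ x)).imp fun _ h => h.2
    · intro v hv w hw h
      refine M.arcRank_injOn a hv hw ?_
      have := arcRank_pos hv
      have := arcRank_pos hw
      have := M.arcRank_le a v
      have := M.arcRank_le a w
      exact ((ZMod.natCast_eq_natCast_iff _ _ _).1 h).eq_of_abs_lt (by rw [abs_lt]; omega)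

theorem card_arcRank_le (hM : M.IsKCore k) (ha : (M.region a).card = k) {j : ℕ} (hj : j < k) :
    ({v | M.arcRank a v ≤ j} : Finset (Fin n)).card =
      ({v | M.arcRank a v = 0} : Finset (Fin n)).card + 4 * j := by
  have : NeZero k := ⟨by omega⟩
  induction j with
  | zero => simp
  | succ j ih =>
    have hlevel : ({v | M.arcRank a v = j + 1} : Finset (Fin n)).card = 4 := by
      rw [← (arcRank_isCrossingLabelling (by omega) ha).card_fiber (by rwa [ZMod.card])
        ((j + 1 : ℕ) : ZMod k)]
      refine congrArg Finset.card (Finset.filter_congr fun v _ => ⟨congrArg _, fun h => ?_⟩)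
      have := M.arcRank_le a v
      exact ((ZMod.natCast_eq_natCast_iff _ _ _).1 h).eq_of_abs_lt (by rw [abs_lt]; omega)
    simp only [Nat.le_succ_iff, Nat.succ_eq_add_one, Finset.filter_or]
    rw [Finset.card_union_of_disjoint, ih (by omega), hlevel, mul_add, mul_one, add_assoc]
    exact Finset.disjoint_filter.2 fun v _ hv => by omega

theorem card_arcRank_eq_zero_lt (hM : M.IsKCore k) (hk : 1 ≤ k) (ha : (M.region a).card = k) :
    ({v | M.arcRank a v = 0} : Finset (Fin n)).card < 4 := by
  have : NeZero k := ⟨by omega⟩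
  rw [← (arcRank_isCrossingLabelling hk ha).card_fiber (by rwa [ZMod.card]) 0]
  obtain ⟨v, hv⟩ := M.exists_arcRank_eq_card a
  refine Finset.card_lt_card ((Finset.ssubset_iff_of_subset ?_).2 ⟨v, ?_⟩)
  · exact Finset.monotone_filter_right _ fun w _ hw => by simp [hw]
  · simp [hv, ha, NeZero.ne k]

theorem arcRank_eq_div (hM : M.IsKCore k) (hk : 1 ≤ k) (ha : (M.region a).card = k) :
    ∃ s < 4, ∀ v, M.arcRank a v = (v + 4 - s) / 4 := by
  have : NeZero k := ⟨by omega⟩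
  refine ⟨_, card_arcRank_eq_zero_lt hM hk ha, fun v => ?_⟩
  have hn := (arcRank_isCrossingLabelling hk ha).eq_four_mul_card (by rwa [ZMod.card])
  rw [ZMod.card] at hn
  have hle {j} (hj : j < k) := (apply_le_iff_lt_card_of_monotone (M.monotone_arcRank a) v j).trans
    (by rw [card_arcRank_le hM ha hj])
  have hs := card_arcRank_eq_zero_lt hM hk ha
  have hrank := M.arcRank_le a v
  refine eq_of_forall_ge_iff fun j => ?_
  rcases lt_or_ge j k with hj | hj
  · rw [hle hj]
    omega
  · omega

end bigRegion

/-- Blocks of four consecutive points around the circle, numbered modulo `k` so that block `1`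
starts at the point `s`. -/
def blockLabel (k s : ℕ) (v : Fin n) : ZMod k := ((v + 4 - s) / 4 : ℕ)

/-- The matching formed by two crossing chords. -/
def cross : PerfectMatching 4 := ⟨![2, 3, 0, 1], by decide⟩

theorem cross_isKCore : cross.IsKCore 1 := by
  constructor <;> decide

theorem card_exposed_cross : cross.exposed.card = 1 := by decide

/-- `k` pairs of crossing chords side by side. -/
def crossPower : (k : ℕ) → PerfectMatching (4 * k)
  | 0 => ⟨fun v => v, fun v => v.elim0⟩
  | k + 1 => (crossPower k).insertAt (Nat.zero_le _) cross

theorem crossPower_isKCore (k : ℕ) : (crossPower k).IsKCore k := by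
  induction k with
  | zero => exact ⟨fun v => v.elim0, by decide⟩
  | succ k ih => exact ih.insertAt _ cross_isKCore

theorem card_exposed_crossPower (k : ℕ) : (crossPower k).exposed.card = k := by
  induction k with
  | zero => decide
  | succ k ih =>
    calc (crossPower (k + 1)).exposed.card
      _ = (crossPower k).exposed.card + cross.exposed.card :=
        card_exposed_insertAt (Nat.zero_le _) _ _ (not_isCovered_zero _)
      _ = k + 1 := by rw [ih, card_exposed_cross]

/-- `k + 1` pairs of crossing chords side by side, rooted before the point `i` of one of the
pairs. -/
def rootedCrossPower (k : ℕ) (i : Fin 4) : PerfectMatching (4 + 4 * k) :=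
  cross.insertAt i.is_lt.le (crossPower k)

theorem rootedCrossPower_isKCore (k : ℕ) (i : Fin 4) : (rootedCrossPower k i).IsKCore (k + 1) :=
  add_comm 1 k ▸ cross_isKCore.insertAt i.is_lt.le (crossPower_isKCore k)

theorem le_potential_rootedCrossPower (k : ℕ) (i : Fin 4) :
    2 * (k + 1) - 3 ≤ (rootedCrossPower k i).potential := by
  let e := insertEquiv 4 (4 * k) i i.is_lt.le
  let S := insert (e (.inl i)) ((crossPower k).exposed.map
    (Function.Embedding.inr.trans e.toEmbedding))
  have sameRegion {a} (ha : a ∈ S) : (rootedCrossPower k i).SameRegion (e (.inl i)) a := by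
    rcases Finset.mem_insert.1 ha with rfl | ha
    · exact SameRegion.refl _ _
    · obtain ⟨u, hu, rfl⟩ := Finset.mem_map.1 ha
      have not_under (y) : ¬ (y < u ∧ u ≤ (crossPower k).1 y) := fun h => (mem_exposed.1 hu).2
        (isCovered_val.2 ⟨y, (crossPower_isKCore k).1 y, h⟩)
      unfold SameRegion
      rw [forall_fin_insert i.is_lt.le]
      exact ⟨fun x _ => by simp [rootedCrossPower, e],
        fun y _ => by simpa [rootedCrossPower, e] using not_under y⟩
  refine le_potential (S := S) ?_ fun a ha b hb => (sameRegion ha).symm.trans (sameRegion hb)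
  rw [Finset.card_insert_of_notMem (by simp), Finset.card_map, card_exposed_crossPower]

theorem closedIco_insertAt {b i : ℕ} (hi : i ≤ n) (M : PerfectMatching n) (B : PerfectMatching b) :
    (M.insertAt hi B).ClosedIco i (i + b) := by
  unfold ClosedIco
  rw [forall_fin_insert hi]
  constructor
  · intro x h₁ h₂
    rw [insertEquiv_inl_val] at h₁ h₂
    split_ifs at h₁ h₂ <;> omega
  · intro y _ _
    rw [insertAt_inr, insertEquiv_inr_val]
    omega

theorem rootedCrossPower_injective {k : ℕ} (hk : 1 ≤ k) :
    Function.Injective (rootedCrossPower k) := by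
  intro i j hij
  wlog hlt : i < j generalizing i j
  · exact (lt_trichotomy i j).elim (absurd · hlt) (·.elim id fun h => (this hij.symm h).symm)
  have hi := closedIco_insertAt i.is_lt.le cross (crossPower k)
  have hj := closedIco_insertAt j.is_lt.le cross (crossPower k)
  change (rootedCrossPower k i).ClosedIco i (i + 4 * k) at hi
  change (rootedCrossPower k j).ClosedIco j (j + 4 * k) at hj
  rw [← hij] at hj
  have hIco : (rootedCrossPower k i).ClosedIco i j := by
    intro v hiv hvj
    have hv := hi v hiv (by omega)
    have hpartner := hj ((rootedCrossPower k i).1 v)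
    rw [apply_apply] at hpartner
    omega
  have := (rootedCrossPower_isKCore k i).add_four_le (a := ⟨i, by omega⟩) hIco hlt
  dsimp only at this
  omega

section classification

variable {k : ℕ}

theorem IsMaximalKCore.le_potential {M : PerfectMatching n} (hk : 1 ≤ k)
    (hM : M.IsMaximalKCore k) : 2 * k - 3 ≤ M.potential := by
  obtain ⟨k, rfl⟩ := Nat.exists_eq_add_of_le' hk
  exact (le_potential_rootedCrossPower k 0).trans (hM.2 _ _ (rootedCrossPower_isKCore k 0))

theorem IsMaximalKCore.exists_blockLabel {M : PerfectMatching n} (hk : 1 ≤ k)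
    (hM : M.IsMaximalKCore k) : ∃ s < 4, M.IsCrossingLabelling (blockLabel k s) := by
  obtain ⟨a, ha⟩ := hM.1.exists_card_region_eq hk (hM.le_potential hk)
  obtain ⟨s, hs, hrank⟩ := arcRank_eq_div hM.1 hk ha
  exact ⟨s, hs, (funext fun v => congrArg _ (hrank v) :
    (fun v => (M.arcRank a v : ZMod k)) = blockLabel k s) ▸ arcRank_isCrossingLabelling hk ha⟩

theorem sigma_eq_of_isCrossingLabelling {s : ℕ} {K K' : Σ n : ℕ, PerfectMatching n} (hk : 1 ≤ k)
    (hK : K.2.IsKCore k) (hK' : K'.2.IsKCore k) (h : K.2.IsCrossingLabelling (blockLabel k s))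
    (h' : K'.2.IsCrossingLabelling (blockLabel k s)) : K = K' := by
  have : NeZero k := ⟨by omega⟩
  rw [← ZMod.card k] at hK hK'
  obtain ⟨n, M⟩ := K
  obtain ⟨n', M'⟩ := K'
  obtain rfl : n = n' := (h.eq_four_mul_card hK).trans (h'.eq_four_mul_card hK').symm
  exact congrArg _ (h.unique hK h' hK')

theorem ncard_setOf_isMaximalKCore_one :
    Set.ncard {K : Σ n : ℕ, PerfectMatching n | K.2.IsMaximalKCore 1} = 1 := by
  have hcross : cross.IsMaximalKCore 1 := cross_isKCore.isMaximalKCore le_rfl (Nat.zero_le _)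
  have hlabel {K : Σ n : ℕ, PerfectMatching n} (hK : K.2.IsMaximalKCore 1) :
      K.2.IsCrossingLabelling (blockLabel 1 0) := by
    obtain ⟨s, -, h⟩ := hK.exists_blockLabel le_rfl
    exact (funext fun _ => Subsingleton.elim (α := Fin 1) _ _ : blockLabel 1 s = blockLabel 1 0) ▸ h
  refine Set.ncard_eq_one.2 ⟨⟨4, cross⟩, Set.eq_singleton_iff_unique_mem.2 ⟨hcross, fun K hK => ?_⟩⟩
  exact sigma_eq_of_isCrossingLabelling (K' := ⟨4, cross⟩) le_rfl hK.1 hcross.1 (hlabel hK)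
    (hlabel hcross)

theorem ncard_setOf_isMaximalKCore (hk : 2 ≤ k) :
    Set.ncard {K : Σ n : ℕ, PerfectMatching n | K.2.IsMaximalKCore k} = 4 := by
  have hlabel (K : Σ n : ℕ, PerfectMatching n) :
      ∃ s, K.2.IsMaximalKCore k → s < 4 ∧ K.2.IsCrossingLabelling (blockLabel k s) := by
    by_cases hK : K.2.IsMaximalKCore k
    · obtain ⟨s, hs⟩ := hK.exists_blockLabel (by omega)
      exact ⟨s, fun _ => hs⟩
    · exact ⟨0, (absurd · hK)⟩
  choose f hf using hlabel
  have hinj : Set.InjOn f {K | K.2.IsMaximalKCore k} := fun K hK K' hK' h =>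
    sigma_eq_of_isCrossingLabelling (by omega) hK.1 hK'.1 (hf K hK).2 (h ▸ (hf K' hK').2)
  have hmaps : Set.MapsTo f {K | K.2.IsMaximalKCore k} (Finset.range 4) := fun K hK =>
    Finset.mem_range.2 (hf K hK).1
  refine le_antisymm ?_ ?_
  · simpa using Set.ncard_le_ncard_of_injOn f hmaps hinj
  · obtain ⟨k, rfl⟩ := Nat.exists_eq_add_of_le' hk
    let g (i : Fin 4) : Σ n : ℕ, PerfectMatching n := ⟨_, rootedCrossPower (k + 1) i⟩
    have hg : Function.Injective g :=
      sigma_mk_injective.comp (rootedCrossPower_injective (Nat.le_add_left 1 k))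
    calc 4 = (Set.range g).ncard := by
          rw [← Set.image_univ, Set.ncard_image_of_injective _ hg, Set.ncard_univ, Nat.card_fin]
      _ ≤ _ := Set.ncard_le_ncard ?_ (.of_injOn hmaps hinj (Finset.finite_toSet _))
    rintro _ ⟨i, rfl⟩
    exact (rootedCrossPower_isKCore (k + 1) i).isMaximalKCore (by omega)
      (le_potential_rootedCrossPower (k + 1) i)

end classification

/-- The matching of two points. -/
def chord : PerfectMatching 2 := ⟨![1, 0], by decide⟩

/-- The noncrossing matchings. -/
def noncrossing (n : ℕ) : Finset (PerfectMatching n) := {M | M.crossings.card = 0}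

theorem mem_noncrossing {M : PerfectMatching n} : M ∈ noncrossing n ↔ M.crossings.card = 0 := by
  simp [noncrossing]

theorem card_noncrossing_mul_le {a b N : ℕ} (h : N = 2 * b + 2 + 2 * a) :
    (noncrossing (2 * a)).card * (noncrossing (2 * b)).card ≤
      {M ∈ noncrossing N | (M.1 ⟨0, by omega⟩ : ℕ) = 2 * a + 1}.card := by
  subst h
  have hi : 1 ≤ 2 * b + 2 := by omega
  have hchord : chord.crossings.card = 0 := by decide
  rw [← Finset.card_product]
  refine Finset.card_le_card_of_injOn
    (fun P => (P.2.insertAt (Nat.zero_le _) chord).insertAt hi P.1) ?_ ?_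
  · rintro ⟨A, B⟩ h
    simp only [Finset.coe_product, Set.mem_prod, Finset.mem_coe, mem_noncrossing] at h
    rw [Finset.mem_coe, Finset.mem_filter, mem_noncrossing]
    refine ⟨by simp only [card_crossings_insertAt, hchord, h], ?_⟩
    have hzero : (⟨0, by omega⟩ : Fin (2 * b + 2 + 2 * a)) = insertEquiv _ _ 1 hi
        (.inl (insertEquiv (2 * b) 2 0 (Nat.zero_le _) (.inr 0))) := by
      simp [Fin.ext_iff, insertEquiv_inl_val, insertEquiv_inr_val]
    rw [hzero, insertAt_inl, insertAt_inr]
    simp [insertEquiv_inl_val, insertEquiv_inr_val, chord, add_comm]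
  · rintro ⟨A, B⟩ - ⟨A', B'⟩ - h
    obtain ⟨houter, rfl⟩ := insertAt_inj _ h
    obtain ⟨rfl, -⟩ := insertAt_inj _ houter
    rfl

theorem catalan_le_card_noncrossing (m : ℕ) : catalan m ≤ (noncrossing (2 * m)).card := by
  induction m using Nat.strong_induction_on with
  | _ m ih =>
  rcases m with _ | m
  · rw [catalan_zero]
    exact Finset.card_pos.2 ⟨crossPower 0, by rw [mem_noncrossing]; decide⟩
  · rw [catalan_succ']
    calc ∑ ij ∈ Finset.HasAntidiagonal.antidiagonal m, catalan ij.1 * catalan ij.2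
        ≤ ∑ ij ∈ Finset.HasAntidiagonal.antidiagonal m, {M ∈ noncrossing (2 * (m + 1)) |
            ((M.1 ⟨0, by omega⟩ : ℕ) - 1) / 2 = ij.1}.card := by
          refine Finset.sum_le_sum fun ⟨a, b⟩ h => ?_
          obtain rfl := Finset.HasAntidiagonal.mem_antidiagonal.1 h
          refine (Nat.mul_le_mul (ih _ (by dsimp; omega)) (ih _ (by dsimp; omega))).trans
            ((card_noncrossing_mul_le (by ring)).trans (Finset.card_le_card ?_))
          exact Finset.monotone_filter_right _ fun M _ h => by dsimp only at h ⊢; omega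
      _ ≤ (noncrossing (2 * (m + 1))).card := by
          rw [Finset.Nat.sum_antidiagonal_eq_sum_range_succ_mk,
            Finset.sum_card_fiberwise_eq_card_filter]
          exact Finset.card_filter_le _ _

/-- Two crossing chords with matchings inserted into three of the arcs between their endpoints. -/
def inflatedCross {a b c : ℕ} (A : PerfectMatching a) (B : PerfectMatching b)
    (C : PerfectMatching c) : PerfectMatching (4 + c + b + a) :=
  ((cross.insertAt (i := 3) (by omega) C).insertAt (i := 2) (by omega) B).insertAt (i := 1)
    (by omega) A

/-- The position in an inflated cross of the four points of its crossing chords. -/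
def inflatedCrossPoint (a b c : ℕ) (x : Fin 4) : Fin (4 + c + b + a) :=
  insertEquiv _ _ 1 (by omega) (.inl (insertEquiv _ _ 2 (by omega)
    (.inl (insertEquiv _ _ 3 (by omega) (.inl x)))))

section inflatedCross

theorem inflatedCrossPoint_val (a b c : ℕ) (x : Fin 4) :
    (inflatedCrossPoint a b c x : ℕ) = ![0, 1 + a, 2 + b + a, 3 + c + b + a] x := by
  match x with
  | 0 | 1 | 2 => simp [inflatedCrossPoint, insertEquiv_inl_val]
  | 3 =>
    have hthree : ((3 : Fin 4) : ℕ) = 3 := rfl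
    simp only [inflatedCrossPoint, insertEquiv_inl_val, hthree, lt_irrefl, if_false,
      show ¬ 3 + c < 2 by omega, show ¬ 3 + c + b < 1 by omega]
    rfl

variable {a b c : ℕ} (A : PerfectMatching a) (B : PerfectMatching b) (C : PerfectMatching c)

theorem inflatedCross_apply_inflatedCrossPoint (x : Fin 4) :
    (inflatedCross A B C).1 (inflatedCrossPoint a b c x) =
      inflatedCrossPoint a b c (cross.1 x) := by
  simp [inflatedCross, inflatedCrossPoint]

theorem inflatedCrossPoint_mem_crossings :
    (inflatedCrossPoint a b c 0, inflatedCrossPoint a b c 1) ∈ (inflatedCross A B C).crossings := by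
  simp only [inflatedCross, inflatedCrossPoint, mem_crossings_insertAt_inl]
  decide

theorem card_crossings_inflatedCross (hA : A.crossings.card = 0) (hB : B.crossings.card = 0)
    (hC : C.crossings.card = 0) : (inflatedCross A B C).crossings.card = 1 := by
  simp only [inflatedCross, card_crossings_insertAt, cross_isKCore.2, hA, hB, hC]

theorem card_exposed_inflatedCross_pos : 0 < (inflatedCross A B C).exposed.card := by
  refine Finset.card_pos.2 ⟨inflatedCrossPoint a b c 0, mem_exposed.2 ⟨?_, ?_⟩⟩
  · exact mem_crossingVertices.2 ⟨_, inflatedCrossPoint_mem_crossings A B C, Or.inl rfl⟩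
  · rw [inflatedCrossPoint_val]
    exact not_isCovered_zero _

theorem inflatedCross_inj {A A' : PerfectMatching a} {B B' : PerfectMatching b}
    {C C' : PerfectMatching c} (h : inflatedCross A B C = inflatedCross A' B' C') :
    A = A' ∧ B = B' ∧ C = C' := by
  obtain ⟨h', hA⟩ := insertAt_inj _ h
  obtain ⟨h'', hB⟩ := insertAt_inj _ h'
  exact ⟨hA, hB, (insertAt_inj _ h'').2⟩

end inflatedCross

/-- The matchings with `k` crossings, at least `k` exposed points and at most `L * k` covered
points. The first bound makes the core maximal; the second leaves room for inserting one more
crossing at a point that is not covered. -/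
def spreadMatchings (L k n : ℕ) : Finset (PerfectMatching n) :=
  {M | M.crossings.card = k ∧ k ≤ M.exposed.card ∧ M.covered.card ≤ L * k}

theorem mem_spreadMatchings {L k : ℕ} {M : PerfectMatching n} : M ∈ spreadMatchings L k n ↔
    M.crossings.card = k ∧ k ≤ M.exposed.card ∧ M.covered.card ≤ L * k := by
  simp [spreadMatchings]

theorem card_spreadMatchings_le {k : ℕ} (hk : 1 ≤ k) (L n : ℕ) :
    (spreadMatchings L k n).card ≤ numMatchingsMaximalCore k n := by
  classical
  rw [numMatchingsMaximalCore, Nat.card_eq_fintype_card, Fintype.card_subtype]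
  refine Finset.card_le_card fun M hM => (Finset.mem_filter_univ M).2 ?_
  obtain ⟨hcard, hexposed, -⟩ := mem_spreadMatchings.1 hM
  exact ⟨hcard, isMaximalKCore_core_of_exposed hk hcard hexposed⟩

theorem catalan_le_card_spreadMatchings_zero (L m : ℕ) :
    catalan m ≤ (spreadMatchings L 0 (2 * m)).card := by
  refine (catalan_le_card_noncrossing m).trans (Finset.card_le_card fun M hM => ?_)
  rw [mem_noncrossing, Finset.card_eq_zero] at hM
  simp [mem_spreadMatchings, covered, IsCovered, hM, crossingVertices]

theorem insertAt_mem_spreadMatchings {L k i : ℕ} {M : PerfectMatching n} {B : PerfectMatching b}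
    (hM : M ∈ spreadMatchings L k n) (hi : i ≤ n) (hc : ¬ M.IsCovered i)
    (hB : B.crossings.card = 1) (hE : 0 < B.exposed.card) (hb : b ≤ L) :
    M.insertAt hi B ∈ spreadMatchings L (k + 1) (n + b) := by
  rw [mem_spreadMatchings] at hM ⊢
  refine ⟨by rw [card_crossings_insertAt, hM.1, hB], ?_, ?_⟩
  · rw [card_exposed_insertAt hi M B hc]
    omega
  · refine (card_covered_insertAt_le hi M B).trans ?_
    rw [mul_add, mul_one]
    omega

/-- The spread matchings with a marked crossing. -/
def markedSpreadMatchings (L k n : ℕ) : Finset (Σ _ : PerfectMatching n, Fin n × Fin n) :=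
  (spreadMatchings L k n).sigma fun M => M.crossings

theorem card_markedSpreadMatchings (L k n : ℕ) :
    (markedSpreadMatchings L k n).card = k * (spreadMatchings L k n).card := by
  rw [markedSpreadMatchings, Finset.card_sigma,
    Finset.sum_congr rfl fun M hM => (mem_spreadMatchings.1 hM).1,
    Finset.sum_const, smul_eq_mul, mul_comm]

/-- The numbers of points in three of the arcs between the endpoints of a marked crossing. -/
def arcSizes (P : Σ _ : PerfectMatching n, Fin n × Fin n) : ℕ × ℕ × ℕ :=
  ((P.2.2 : ℕ) - P.2.1 - 1, (P.1.1 P.2.1 : ℕ) - P.2.2 - 1, (P.1.1 P.2.2 : ℕ) - P.1.1 P.2.1 - 1)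

/-- Insert the inflated cross of `P.1` into the matching `P.2.1` before the point `P.2.2`, and mark
its crossing. -/
def insertCross {a b c : ℕ} (P : (PerfectMatching a × PerfectMatching b × PerfectMatching c) ×
    (Σ _ : PerfectMatching n, Fin n)) : Σ _ : PerfectMatching (n + (4 + c + b + a)),
      Fin (n + (4 + c + b + a)) × Fin (n + (4 + c + b + a)) :=
  ⟨P.2.1.insertAt P.2.2.is_lt.le (inflatedCross P.1.1 P.1.2.1 P.1.2.2),
    insertEquiv _ _ _ P.2.2.is_lt.le (.inr (inflatedCrossPoint a b c 0)),
    insertEquiv _ _ _ P.2.2.is_lt.le (.inr (inflatedCrossPoint a b c 1))⟩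

section insertCross

variable {a b c : ℕ}

theorem insertCross_injective : Function.Injective (insertCross (n := n) (a := a) (b := b)
    (c := c)) := by
  rintro ⟨⟨A, B, C⟩, M, i⟩ ⟨⟨A', B', C'⟩, M', i'⟩ h
  simp only [insertCross, Sigma.mk.injEq, heq_eq_eq, Prod.mk.injEq] at h
  obtain ⟨hmatching, hpoint, -⟩ := h
  obtain rfl : i = i' := by
    simpa [Fin.ext_iff, insertEquiv_inr_val, inflatedCrossPoint_val] using hpoint
  obtain ⟨rfl, hcross⟩ := insertAt_inj _ hmatching
  obtain ⟨rfl, rfl, rfl⟩ := inflatedCross_inj hcross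
  rfl

theorem arcSizes_insertCross (P : (PerfectMatching a × PerfectMatching b × PerfectMatching c) ×
    (Σ _ : PerfectMatching n, Fin n)) : arcSizes (insertCross P) = (a, b, c) := by
  have h₀ : cross.1 0 = 2 := rfl
  have h₁ : cross.1 1 = 3 := rfl
  simp only [arcSizes, insertCross, insertAt_inr, inflatedCross_apply_inflatedCrossPoint,
    insertEquiv_inr_val, inflatedCrossPoint_val, h₀, h₁, Prod.mk.injEq]
  simp only [Nat.succ_eq_add_one, Nat.reduceAdd, Fin.isValue, Matrix.cons_val_one,
    Matrix.cons_val_zero, add_zero, add_tsub_cancel_left, Matrix.cons_val, true_and]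
  omega

theorem insertCross_mem_markedSpreadMatchings {L k : ℕ} (hL : 4 + c + b + a ≤ L)
    {A : PerfectMatching a} {B : PerfectMatching b} {C : PerfectMatching c}
    {M : PerfectMatching n} {i : Fin n} (hA : A ∈ noncrossing a) (hB : B ∈ noncrossing b)
    (hC : C ∈ noncrossing c) (hM : M ∈ spreadMatchings L k n) (hi : i ∉ M.covered) :
    insertCross ((A, B, C), ⟨M, i⟩) ∈ markedSpreadMatchings L (k + 1) _ := by
  rw [mem_noncrossing] at hA hB hC
  exact Finset.mem_sigma.2 ⟨insertAt_mem_spreadMatchings hM _ (mt mem_covered.2 hi)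
    (card_crossings_inflatedCross A B C hA hB hC) (card_exposed_inflatedCross_pos A B C) hL,
    (mem_crossings_insertAt_inr _ _ _).2 (inflatedCrossPoint_mem_crossings A B C)⟩

theorem le_card_sigma_compl_covered (L k n : ℕ) : (n - L * k) * (spreadMatchings L k n).card ≤
    ((spreadMatchings L k n).sigma fun M => M.coveredᶜ).card := by
  rw [Finset.card_sigma, mul_comm, ← smul_eq_mul]
  refine Finset.card_nsmul_le_sum _ _ _ fun M hM => ?_
  rw [Finset.card_compl, Fintype.card_fin]
  exact Nat.sub_le_sub_left (mem_spreadMatchings.1 hM).2.2 n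

theorem mul_card_spreadMatchings_le {L k N : ℕ} (h : N = n + (4 + c + b + a))
    (hL : 4 + c + b + a ≤ L) :
    (noncrossing a).card * ((noncrossing b).card * (noncrossing c).card) *
        ((n - L * k) * (spreadMatchings L k n).card) ≤
      {P ∈ markedSpreadMatchings L (k + 1) N | arcSizes P = (a, b, c)}.card := by
  subst h
  refine (Nat.mul_le_mul_left _ (le_card_sigma_compl_covered L k n)).trans ?_
  rw [← Finset.card_product, ← Finset.card_product, ← Finset.card_product]
  refine Finset.card_le_card_of_injOn insertCross (fun P hP => ?_) insertCross_injective.injOn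
  simp only [Finset.mem_coe, Finset.mem_product, Finset.mem_sigma, Finset.mem_compl] at hP
  obtain ⟨⟨hA, hB, hC⟩, hM, hi⟩ := hP
  exact Finset.mem_filter.2
    ⟨insertCross_mem_markedSpreadMatchings hL hA hB hC hM hi, arcSizes_insertCross P⟩

end insertCross

/-- The triples of numbers of chords, all less than `L`, of the noncrossing matchings inserted into
a cross. -/
def arcTriples (L : ℕ) : Finset (ℕ × ℕ × ℕ) :=
  Finset.range L ×ˢ Finset.range L ×ˢ Finset.range L

/-- The number of chords of a cross inflated by matchings with `t.1`, `t.2.1` and `t.2.2` chords. -/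
def inflatedCrossChords (t : ℕ × ℕ × ℕ) : ℕ := 2 + t.1 + t.2.1 + t.2.2

/-- The number of triples of noncrossing matchings with `t.1`, `t.2.1` and `t.2.2` chords. -/
def catalanTriple (t : ℕ × ℕ × ℕ) : ℕ := catalan t.1 * (catalan t.2.1 * catalan t.2.2)

theorem sum_mul_card_spreadMatchings_le (L k m : ℕ) (hm : 3 * L + 2 ≤ m) :
    ∑ t ∈ arcTriples L, catalanTriple t * ((2 * (m - inflatedCrossChords t) - (6 * L + 4) * k) *
        (spreadMatchings (6 * L + 4) k (2 * (m - inflatedCrossChords t))).card) ≤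
      (k + 1) * (spreadMatchings (6 * L + 4) (k + 1) (2 * m)).card := by
  let halve (s : ℕ × ℕ × ℕ) : ℕ × ℕ × ℕ := (s.1 / 2, s.2.1 / 2, s.2.2 / 2)
  rw [← card_markedSpreadMatchings]
  calc _ ≤ ∑ t ∈ arcTriples L,
        {P ∈ markedSpreadMatchings (6 * L + 4) (k + 1) (2 * m) | halve (arcSizes P) = t}.card := by
        refine Finset.sum_le_sum fun ⟨a, b, c⟩ ht => ?_
        simp only [arcTriples, Finset.mem_product, Finset.mem_range] at ht
        simp only [catalanTriple, inflatedCrossChords]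
        refine (Nat.mul_le_mul_right _ (Nat.mul_le_mul (catalan_le_card_noncrossing a)
          (Nat.mul_le_mul (catalan_le_card_noncrossing b)
            (catalan_le_card_noncrossing c)))).trans ?_
        refine (mul_card_spreadMatchings_le (N := 2 * m) (by omega) (by omega)).trans ?_
        exact Finset.card_le_card <|
          Finset.monotone_filter_right _ fun P _ h => by simp [h, halve]
    _ ≤ _ := by
        rw [Finset.sum_card_fiberwise_eq_card_filter]
        exact Finset.card_filter_le _ _

end PerfectMatching

section Asymptotics

open Filter Topology

theorem centralBinom_div_mul_sqrt {m : ℕ} (hm : m ≠ 0) :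
    (m.centralBinom : ℝ) / 4 ^ m * √m =
      Stirling.stirlingSeq (2 * m) / Stirling.stirlingSeq m ^ 2 := by
  have hbinom : (m.centralBinom : ℝ) = (2 * m).factorial / (m.factorial : ℝ) ^ 2 := by
    rw [Nat.centralBinom_eq_two_mul_choose, Nat.cast_choose ℝ (by lia : m ≤ 2 * m),
      show 2 * m - m = m by lia, sq]
  have hsqrt : √(2 * ((2 * m : ℕ) : ℝ)) = 2 * √m := by
    rw [show (2 * ((2 * m : ℕ) : ℝ)) = 2 ^ 2 * m by push_cast; ring,
      Real.sqrt_mul (by positivity), Real.sqrt_sq (by norm_num)]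
  have hpow : (((2 * m : ℕ) : ℝ) / Real.exp 1) ^ (2 * m) =
      4 ^ m * (((m : ℝ) / Real.exp 1) ^ m) ^ 2 := by
    rw [← pow_mul, mul_comm m 2, show ((2 * m : ℕ) : ℝ) / Real.exp 1 = 2 * (m / Real.exp 1) by
      push_cast; ring, mul_pow, pow_mul 2 2 m]
    norm_num
  rw [Stirling.stirlingSeq, Stirling.stirlingSeq, hbinom, hsqrt, hpow]
  have hm' : (0 : ℝ) < m := by exact_mod_cast Nat.pos_of_ne_zero hm
  have hne : ((m : ℝ) / Real.exp 1) ^ m ≠ 0 := by positivity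
  generalize ((m : ℝ) / Real.exp 1) ^ m = x at *
  rw [div_pow, mul_pow, Real.sq_sqrt (by positivity)]
  field_simp
  rw [Real.sq_sqrt hm'.le]

theorem tendsto_centralBinom_div_mul_sqrt :
    Tendsto (fun m : ℕ => (m.centralBinom : ℝ) / 4 ^ m * √m) atTop (𝓝 (1 / √Real.pi)) := by
  have hstirling := Stirling.tendsto_stirlingSeq_sqrt_pi
  have hdouble : Tendsto (fun m : ℕ => Stirling.stirlingSeq (2 * m)) atTop (𝓝 (√Real.pi)) :=
    hstirling.comp (tendsto_id.const_mul_atTop' two_pos)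
  have hquot := hdouble.div (hstirling.pow 2) (by positivity)
  rw [show √Real.pi / √Real.pi ^ 2 = 1 / √Real.pi by field_simp] at hquot
  refine hquot.congr' ?_
  filter_upwards [eventually_ne_atTop 0] with m hm
  exact (centralBinom_div_mul_sqrt hm).symm

theorem tendsto_centralBinom_div :
    Tendsto (fun m : ℕ => (m.centralBinom : ℝ) / 4 ^ m) atTop (𝓝 0) := by
  have hinv : Tendsto (fun m : ℕ => (√(m : ℝ))⁻¹) atTop (𝓝 0) :=
    (Real.tendsto_sqrt_atTop.comp tendsto_natCast_atTop_atTop).inv_tendsto_atTop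
  have hprod := tendsto_centralBinom_div_mul_sqrt.mul hinv
  rw [mul_zero] at hprod
  refine hprod.congr' ?_
  filter_upwards [eventually_ne_atTop 0] with m hm
  exact mul_inv_cancel_right₀ (by positivity) _

theorem cast_succ_mul_catalan (m : ℕ) : ((m : ℝ) + 1) * catalan m = m.centralBinom := by
  exact_mod_cast succ_mul_catalan_eq_centralBinom m

theorem tendsto_catalan_div :
    Tendsto (fun m : ℕ => (catalan m : ℝ) / (4 ^ m * (m : ℝ) ^ (-(3 / 2) : ℝ))) atTop
      (𝓝 (1 / √Real.pi)) := by
  have h := tendsto_centralBinom_div_mul_sqrt.mul (tendsto_natCast_div_add_atTop (1 : ℝ))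
  rw [mul_one] at h
  refine h.congr' ?_
  filter_upwards [eventually_ne_atTop 0] with m hm
  have hm' : (0 : ℝ) < m := by exact_mod_cast Nat.pos_of_ne_zero hm
  have hrpow : (m : ℝ) ^ (-(3 / 2) : ℝ) = 1 / (√m * m) := by
    rw [Real.rpow_neg hm'.le, show (3 / 2 : ℝ) = 1 / 2 + 1 by norm_num, Real.rpow_add_one hm'.ne',
      ← Real.sqrt_eq_rpow, one_div]
  rw [hrpow, ← cast_succ_mul_catalan]
  field_simp

theorem sum_catalan_div (L : ℕ) :
    ∑ a ∈ Finset.range L, (catalan a : ℝ) / 4 ^ a = 2 * (1 - (L.centralBinom : ℝ) / 4 ^ L) := by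
  induction L with
  | zero => simp
  | succ L ih =>
    have hsucc : ((L + 1).centralBinom : ℝ) = 2 * (2 * L + 1) * catalan L := by
      have h : ((L : ℝ) + 1) * (L + 1).centralBinom = 2 * (2 * L + 1) * L.centralBinom := by
        exact_mod_cast Nat.succ_mul_centralBinom_succ L
      rw [← cast_succ_mul_catalan L] at h
      exact mul_left_cancel₀ (by positivity : (L : ℝ) + 1 ≠ 0) (by rw [h]; ring)
    rw [Finset.sum_range_succ, ih, hsucc, ← cast_succ_mul_catalan, pow_succ]
    field_simp
    ring

theorem tendsto_sum_catalan_div :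
    Tendsto (fun L : ℕ => ∑ a ∈ Finset.range L, (catalan a : ℝ) / 4 ^ a) atTop (𝓝 2) := by
  simp only [sum_catalan_div]
  simpa using (tendsto_centralBinom_div.const_sub 1).const_mul 2

theorem tendsto_natCast_sub_div (j : ℕ) :
    Tendsto (fun m : ℕ => ((m - j : ℕ) : ℝ) / m) atTop (𝓝 1) := by
  have h : Tendsto (fun m : ℕ => 1 - (j : ℝ) / m) atTop (𝓝 1) := by
    simpa using (tendsto_const_div_atTop_nhds_zero_nat (j : ℝ)).const_sub 1
  refine h.congr' ?_
  filter_upwards [eventually_ge_atTop j, eventually_ne_atTop 0] with m hj hm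
  rw [Nat.cast_sub hj]
  field_simp

theorem tendsto_two_mul_sub_div (j d : ℕ) :
    Tendsto (fun m : ℕ => ((2 * (m - j) - d : ℕ) : ℝ) / m) atTop (𝓝 2) := by
  have h := ((tendsto_natCast_sub_div j).const_mul 2).sub
    (tendsto_const_div_atTop_nhds_zero_nat (d : ℝ))
  rw [mul_one, sub_zero] at h
  refine h.congr' ?_
  filter_upwards [eventually_ge_atTop (j + d)] with m hm
  rw [Nat.cast_sub (by lia : d ≤ 2 * (m - j)), Nat.cast_mul]
  push_cast
  ring

theorem exists_lt_lt_mul {a b x : ℝ} (h : a < b * x) : ∃ y < x, a < b * y := by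
  have hlim := ((continuous_const_mul b).tendsto x).mono_left (nhdsWithin_le_nhds (s := Set.Iio x))
  exact (eventually_mem_nhdsWithin.and (hlim.eventually_const_lt h)).exists

namespace PerfectMatching

/-- The order of growth `4 ^ m * m ^ (k - 3 / 2)` of the number of matchings with `k` crossings on
`2 * m` points. -/
noncomputable def growth (k m : ℕ) : ℝ := 4 ^ m * (m : ℝ) ^ ((k : ℝ) - 3 / 2)

theorem growth_pos (k : ℕ) {m : ℕ} (hm : m ≠ 0) : 0 < growth k m := by
  unfold growth
  positivity

theorem growth_succ (k : ℕ) {m : ℕ} (hm : m ≠ 0) : growth (k + 1) m = growth k m * m := by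
  rw [growth, growth, mul_assoc, ← Real.rpow_add_one (Nat.cast_ne_zero.2 hm)]
  congr 2
  push_cast
  ring

theorem growth_eq_mul_pow (k : ℕ) {m : ℕ} (hm : m ≠ 0) :
    growth k m = 4 ^ m * (m : ℝ) ^ (-(3 / 2) : ℝ) * (m : ℝ) ^ k := by
  induction k with
  | zero => simp [growth]
  | succ k ih => rw [growth_succ k hm, ih, pow_succ]; ring

theorem tendsto_growth_sub_div (k j : ℕ) :
    Tendsto (fun m : ℕ => growth k (m - j) / growth k m) atTop (𝓝 ((1 / 4) ^ j)) := by
  have h := ((tendsto_natCast_sub_div j).rpow_const (p := (k : ℝ) - 3 / 2)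
    (Or.inl one_ne_zero)).const_mul ((1 / 4 : ℝ) ^ j)
  rw [Real.one_rpow, mul_one] at h
  refine h.congr' ?_
  filter_upwards [eventually_ge_atTop j, eventually_ne_atTop 0] with m hj hm
  have hm' : (0 : ℝ) < m := by exact_mod_cast Nat.pos_of_ne_zero hm
  have hfour : (4 : ℝ) ^ m = 4 ^ (m - j) * 4 ^ j := by rw [← pow_add, Nat.sub_add_cancel hj]
  rw [growth, growth, Real.div_rpow (by positivity) (by positivity), hfour, one_div, inv_pow]
  have := (Real.rpow_pos_of_pos hm' ((k : ℝ) - 3 / 2)).ne'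
  field_simp

theorem tendsto_catalan_mul_choose_div_growth {k : ℕ} (hk : 1 ≤ k) :
    Tendsto (fun m : ℕ => ((catalan m * (m + k - 1).choose k : ℕ) : ℝ) / growth k m) atTop
      (𝓝 (1 / (k.factorial * √Real.pi))) := by
  obtain ⟨k, rfl⟩ := Nat.exists_eq_add_of_le' hk
  have hratio : Tendsto (fun m : ℕ => ((m + k : ℕ) : ℝ) / m) atTop (𝓝 1) := by
    have h : Tendsto (fun m : ℕ => 1 + (k : ℝ) / m) atTop (𝓝 1) := by
      simpa using (tendsto_const_div_atTop_nhds_zero_nat (k : ℝ)).const_add 1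
    refine h.congr' ?_
    filter_upwards [eventually_ne_atTop 0] with m hm
    push_cast
    field_simp
  have hchoose : Tendsto (fun n : ℕ =>
      (n.choose (k + 1) : ℝ) / ((n : ℝ) ^ (k + 1) / (k + 1).factorial)) atTop (𝓝 1) := by
    refine (Asymptotics.isEquivalent_iff_tendsto_one ?_).1 (isEquivalent_choose (k + 1))
    filter_upwards [eventually_ne_atTop 0] with n hn
    positivity
  have hlim := tendsto_catalan_div.mul <|
    ((hchoose.comp (tendsto_add_atTop_nat k)).mul (hratio.pow (k + 1))).div_const
      ((k + 1).factorial : ℝ)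
  rw [one_pow, mul_one, one_div_mul_one_div, mul_comm √Real.pi] at hlim
  refine hlim.congr' ?_
  filter_upwards [eventually_ne_atTop 0] with m hm
  have hm' : (0 : ℝ) < m := by exact_mod_cast Nat.pos_of_ne_zero hm
  have hrpow := (Real.rpow_pos_of_pos hm' (-(3 / 2))).ne'
  rw [growth_eq_mul_pow _ hm, ← add_assoc, Nat.add_sub_cancel]
  simp only [Function.comp_apply, Nat.cast_mul]
  rw [div_pow]
  field_simp

/-- The generating function of `catalanTriple` truncated to `arcTriples L`, weighted so as to be the
factor that each inflated cross contributes to the count of spread matchings. -/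
noncomputable def crossWeight (L : ℕ) : ℝ :=
  (∑ a ∈ Finset.range L, (catalan a : ℝ) / 4 ^ a) ^ 3 / 8

theorem tendsto_crossWeight : Tendsto crossWeight atTop (𝓝 1) := by
  have h := (tendsto_sum_catalan_div.pow 3).div_const 8
  norm_num at h
  exact h

theorem crossWeight_eq_sum (L : ℕ) :
    crossWeight L =
      ∑ t ∈ arcTriples L, (catalanTriple t : ℝ) * (2 * (1 / 4) ^ inflatedCrossChords t) := by
  have hterm (t : ℕ × ℕ × ℕ) : (catalanTriple t : ℝ) * (2 * (1 / 4) ^ inflatedCrossChords t) =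
      (catalan t.1 : ℝ) / 4 ^ t.1 *
        ((catalan t.2.1 : ℝ) / 4 ^ t.2.1 * ((catalan t.2.2 : ℝ) / 4 ^ t.2.2)) * (1 / 8) := by
    rw [catalanTriple, inflatedCrossChords, pow_add, pow_add, pow_add]
    push_cast
    simp only [one_div, inv_pow]
    field_simp
    ring
  rw [Finset.sum_congr rfl fun t _ => hterm t, ← Finset.sum_mul, arcTriples, Finset.sum_product]
  simp_rw [Finset.sum_product, ← Finset.mul_sum]
  rw [← Finset.sum_mul, ← Finset.sum_mul, crossWeight]
  ring

theorem tendsto_sum_catalanTriple_div_growth (L d k : ℕ) :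
    Tendsto (fun m => (∑ t ∈ arcTriples L, (catalanTriple t : ℝ) *
        (((2 * (m - inflatedCrossChords t) - d : ℕ) : ℝ) *
          growth k (m - inflatedCrossChords t))) / growth (k + 1) m) atTop
      (𝓝 (crossWeight L)) := by
  rw [crossWeight_eq_sum]
  refine (tendsto_finsetSum (arcTriples L) fun t _ =>
    ((tendsto_two_mul_sub_div (inflatedCrossChords t) d).mul
      (tendsto_growth_sub_div k (inflatedCrossChords t))).const_mul
        (catalanTriple t : ℝ)).congr' ?_
  filter_upwards [eventually_ne_atTop 0] with m hm
  rw [Finset.sum_div]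
  refine Finset.sum_congr rfl fun t _ => ?_
  rw [growth_succ k hm]
  have := (growth_pos k hm).ne'
  field_simp

theorem eventually_mul_growth_le_card_spreadMatchings (L k : ℕ) :
    ∀ c < crossWeight L ^ k / (k.factorial * √Real.pi), ∀ᶠ m : ℕ in atTop,
      c * growth k m ≤ (spreadMatchings (6 * L + 4) k (2 * m)).card := by
  induction k with
  | zero =>
    intro c hc
    rw [pow_zero, Nat.factorial_zero, Nat.cast_one, one_mul] at hc
    filter_upwards [tendsto_catalan_div.eventually_const_lt hc, eventually_ne_atTop 0] with m hm hm0
    have hcat : c * growth 0 m ≤ catalan m :=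
      ((lt_div_iff₀ (growth_pos 0 hm0)).1 (by simpa [growth] using hm)).le
    exact hcat.trans (Nat.cast_le.2 (catalan_le_card_spreadMatchings_zero _ m))
  | succ k ih =>
    intro c hc
    have hx : (k + 1) * c < crossWeight L * (crossWeight L ^ k / (k.factorial * √Real.pi)) := by
      rw [pow_succ, Nat.factorial_succ, lt_div_iff₀ (by positivity)] at hc
      rw [mul_div_assoc', lt_div_iff₀ (by positivity)]
      push_cast at hc
      linarith
    obtain ⟨c', hc', hcc'⟩ := exists_lt_lt_mul hx
    have hih : ∀ᶠ m in atTop, ∀ t ∈ arcTriples L,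
        c' * growth k (m - inflatedCrossChords t) ≤
          (spreadMatchings (6 * L + 4) k (2 * (m - inflatedCrossChords t))).card :=
      (eventually_all_finset _).2 fun t _ => (tendsto_sub_atTop_nat _).eventually (ih c' hc')
    have hlim := (tendsto_sum_catalanTriple_div_growth L ((6 * L + 4) * k) k).mul_const c'
    filter_upwards [hih, hlim.eventually_const_lt hcc', eventually_ge_atTop (3 * L + 2)]
      with m hm hsum hmL
    rw [div_mul_eq_mul_div, lt_div_iff₀ (growth_pos (k + 1) (by lia))] at hsum
    have hcount := (Nat.cast_le (α := ℝ)).2 (sum_mul_card_spreadMatchings_le L k m hmL)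
    simp only [Nat.cast_sum, Nat.cast_mul, Nat.cast_add, Nat.cast_one] at hcount
    refine le_of_mul_le_mul_left ?_ (by positivity : (0 : ℝ) < k + 1)
    rw [← mul_assoc]
    refine hsum.le.trans (le_trans ?_ hcount)
    rw [Finset.sum_mul]
    refine Finset.sum_le_sum fun t ht => ?_
    rw [mul_assoc, mul_assoc, mul_comm (growth _ _)]
    gcongr
    exact hm t ht

theorem tendsto_div_growth {k : ℕ} (hk : 1 ≤ k) {f : ℕ → ℕ}
    (hlower : ∀ m, numMatchingsMaximalCore k (2 * m) ≤ f m)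
    (hupper : ∀ m, f m ≤ numMatchings k (2 * m)) :
    Tendsto (fun m => (f m : ℝ) / growth k m) atTop (𝓝 (1 / (k.factorial * √Real.pi))) := by
  rw [tendsto_order]
  constructor
  · intro c hc
    obtain ⟨c', hcc', hc'⟩ := exists_between hc
    have hweight : Tendsto (fun L => crossWeight L ^ k / (k.factorial * √Real.pi)) atTop
        (𝓝 (1 / (k.factorial * √Real.pi))) := by
      simpa using (tendsto_crossWeight.pow k).div_const (k.factorial * √Real.pi)
    obtain ⟨L, hL⟩ := (hweight.eventually_const_lt hc').exists
    filter_upwards [eventually_mul_growth_le_card_spreadMatchings L k c' hL,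
      eventually_ne_atTop 0] with m hm hm0
    refine hcc'.trans_le ((le_div_iff₀ (growth_pos k hm0)).2 (hm.trans ?_))
    exact_mod_cast (card_spreadMatchings_le hk _ _).trans (hlower m)
  · intro c hc
    filter_upwards [(tendsto_catalan_mul_choose_div_growth hk).eventually_lt_const hc,
      eventually_ne_atTop 0] with m hm hm0
    refine lt_of_le_of_lt (div_le_div_of_nonneg_right ?_ (growth_pos k hm0).le) hm
    exact_mod_cast (hupper m).trans (numMatchings_le k m)

theorem isEquivalent_growth {k : ℕ} (hk : 1 ≤ k) {f : ℕ → ℕ}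
    (hlower : ∀ m, numMatchingsMaximalCore k (2 * m) ≤ f m)
    (hupper : ∀ m, f m ≤ numMatchings k (2 * m)) :
    Asymptotics.IsEquivalent atTop (fun m => (f m : ℝ))
      fun m => 1 / (k.factorial * √Real.pi) * growth k m := by
  have hconst : 1 / (k.factorial * √Real.pi) ≠ 0 := by positivity
  apply Asymptotics.isEquivalent_of_tendsto_one
  have h := (tendsto_div_growth hk hlower hupper).div_const (1 / (k.factorial * √Real.pi))
  rw [div_self hconst] at h
  refine h.congr fun m => ?_
  rw [Pi.div_apply, div_div, mul_comm]

end PerfectMatching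

open scoped Nat in
theorem doubleFactorial_div_gamma {k : ℕ} (hk : 1 ≤ k) :
    ((2 * k - 3)‼ : ℝ) / (2 ^ (k - 1) * (k ! : ℝ) * Real.Gamma ((k : ℝ) - 1 / 2)) =
      1 / (k ! * √Real.pi) := by
  obtain ⟨k, rfl⟩ := Nat.exists_eq_add_of_le' hk
  have hGamma : Real.Gamma (((k + 1 : ℕ) : ℝ) - 1 / 2) = (2 * k - 1 : ℕ)‼ * √Real.pi / 2 ^ k := by
    rw [← Real.Gamma_nat_add_half]
    congr 1
    push_cast
    ring
  have hpos : ((2 * k - 1 : ℕ)‼ : ℝ) ≠ 0 := by exact_mod_cast (Nat.doubleFactorial_pos _).ne'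
  rw [hGamma, show 2 * (k + 1) - 3 = 2 * k - 1 by lia, Nat.add_sub_cancel]
  field_simp

end Asymptotics

open Filter Asymptotics Nat in
/-- For `k = 1` the truncated `2 * k - 3` is `0` and `0‼ = 1` is the convention `(-1)!! = 1`. -/
theorem mainTheorem2 (k : ℕ) (hk : 1 ≤ k) :
    ((fun m : ℕ => (numMatchings k (2 * m) : ℝ)) ~[atTop]
      fun m : ℕ =>
        ((2 * k - 3)‼ : ℝ) / (2 ^ (k - 1) * (k ! : ℝ) * Real.Gamma ((k : ℝ) - 1 / 2)) *
          (m : ℝ) ^ ((k : ℝ) - 3 / 2) * 4 ^ m) ∧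
    ((fun m : ℕ => (numMatchingsMaximalCore k (2 * m) : ℝ)) ~[atTop]
      fun m : ℕ => (numMatchings k (2 * m) : ℝ)) ∧
    Set.ncard {K : Σ n : ℕ, PerfectMatching n | K.2.IsMaximalKCore k} =
      (if k = 1 then 1 else 4) := by
  have hnum := PerfectMatching.isEquivalent_growth hk (f := fun m => numMatchings k (2 * m))
    (fun m => PerfectMatching.numMatchingsMaximalCore_le k (2 * m)) fun _ => le_rfl
  have hmax := PerfectMatching.isEquivalent_growth hk
    (f := fun m => numMatchingsMaximalCore k (2 * m))
    (fun _ => le_rfl) fun m => PerfectMatching.numMatchingsMaximalCore_le k (2 * m)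
  refine ⟨?_, hmax.trans hnum.symm, ?_⟩
  · rw [doubleFactorial_div_gamma hk]
    convert hnum using 2 with m
    rw [PerfectMatching.growth, mul_assoc, mul_comm (4 ^ m)]
  · split_ifs with h
    · subst h
      exact PerfectMatching.ncard_setOf_isMaximalKCore_one
    · exact PerfectMatching.ncard_setOf_isMaximalKCore (by lia)
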